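/- Let $p$ be a prime, $k$ an algebraically closed field of characteristic $p$, $G$ a finite group and $S$ a Sylow $p$-subgroup of $G$. All $kG$-modules are finitely generated and all $G$-sets are finite and non-empty. A $p$-permutation module is a direct summand of a permutation module (a module with a $G$-invariant $k$-basis). A vertex of an indecomposable $kG$-module $U$ is a subgroup $H\le G$ minimal with the property that $U$ is a direct summand of $\mathrm{Ind}_H^G\mathrm{Res}^G_H U$; a Sylow-vertex component of $M$ is an indecomposable direct summand of $M$ having a Sylow $p$-subgroup of $G$ as a vertex. A $kG$-module $M$ is a Dade module if $\mathrm{End}_k(M)\cong k^n\oplus W$ for some $n\ge 0$ and some $p$-permutation module $W$ without Sylow-vertex components; it is capped if it has a Sylow-vertex component. Two capped Dade modules $M,N$ are compatible if $M\oplus N$ is a Dade module. For a $G$-set $X$ let $\Delta(X)$ be the kernel of the augmentation map $kX\to k$, $\sum c_x x\mapsto\sum c_x$. Let $C(G,p)$ be the additive group of functions from the set of $p$-subgroups of $G$ to $\mathbb Z$ that are constant on $G$-conjugacy classes, and let $\omega_X\in C(G,p)$ be given by $\omega_X(P)=1$ if $X^P\ne\emptyset$ and $\omega_X(P)=0$ otherwise.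 Then compatibility is an equivalence relation on capped Dade modules, and the set $D(G)$ of equivalence classes is an abelian group under $[M]+[N]=[M\otimes_k N]$ (in particular, $M\otimes_k N$ is again a capped Dade module). If $X^S=\emptyset$, then $\Delta(X)$ is a capped Dade module; put $\Omega_X=[\Delta(X)]\in D(G)$ in this case, and $\Omega_X=0$ if $X^S\neq\emptyset$. Let $D^\Omega(G)\le D(G)$ be the subgroup generated by the elements $\Omega_X$ for all $G$-sets $X$. There is a surjective group homomorphism $$\Psi_G: C(G,p)\to D^\Omega(G)$$ such that $\Psi_G(\omega_X)=\Omega_X$ for every $G$-set $X$. -/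

import Mathlib

open Representation

universe u v

namespace Dade

/-! ### Modules over a group algebra

A `kG`-module is a representation `ρ : Representation k G V`. -/

section Modules

variable {k : Type*} [Field k] {G : Type*} [Group G]

/-- `σ` is (isomorphic to) a direct summand of `ρ`, i.e. `σ ∣ ρ`: there is a `G`-equivariant
split injection of `σ` into `ρ`. -/
def IsSummand {U V : Type*} [AddCommGroup U] [Module k U] [AddCommGroup V] [Module k V]
    (σ : Representation k G U) (ρ : Representation k G V) : Prop :=
  ∃ (i : IntertwiningMap σ ρ) (r : IntertwiningMap ρ σ), r.comp i = IntertwiningMap.id σ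

/-- Indecomposable modules: nonzero, and not an internal direct sum of two nonzero submodules. -/
def IsIndecomposable {V : Type*} [AddCommGroup V] [Module k V]
    (ρ : Representation k G V) : Prop :=
  Nontrivial V ∧ ∀ A B : Subrepresentation ρ, IsCompl A.toSubmodule B.toSubmodule →
    A.toSubmodule = ⊥ ∨ B.toSubmodule = ⊥

/-- Restriction to a subgroup. -/
abbrev res (H : Subgroup G) {V : Type*} [AddCommGroup V] [Module k V]
    (ρ : Representation k G V) : Representation k H V :=
  ρ.comp H.subtype

/-- `ρ` is relatively `H`-projective: it is a direct summand of `Ind_H^G Res_H^G ρ`. -/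
def IsRelProjective (H : Subgroup G) {V : Type*} [AddCommGroup V] [Module k V]
    (ρ : Representation k G V) : Prop :=
  IsSummand ρ (Representation.ind H.subtype (res H ρ))

/-- `H` is a vertex of the (indecomposable) module `ρ`: it is minimal among the subgroups such that
`ρ` is a direct summand of `Ind_H^G Res_H^G ρ`. -/
def IsVertex (H : Subgroup G) {V : Type*} [AddCommGroup V] [Module k V]
    (ρ : Representation k G V) : Prop :=
  Minimal (fun K : Subgroup G => IsRelProjective K ρ) H

/-- (Finitely generated) permutation modules: there is a `G`-invariant `k`-basis. -/
def IsPermutation {V : Type*} [AddCommGroup V] [Module k V]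
    (ρ : Representation k G V) : Prop :=
  ∃ (n : ℕ) (b : Module.Basis (Fin n) k V), ∀ (g : G) (i : Fin n), ∃ j : Fin n, ρ g (b i) = b j

end Modules

section DadeModules

variable {k : Type u} [Field k] {G : Type v} [Group G]

/-- `p`-permutation modules: direct summands of permutation modules. -/
def IsPPermutation {V : Type u} [AddCommGroup V] [Module k V]
    (ρ : Representation k G V) : Prop :=
  ∃ (P : Type u) (_ : AddCommGroup P) (_ : Module k P) (π : Representation k G P),
    IsPermutation π ∧ IsSummand ρ π

/-- `ρ` has a Sylow-vertex component: an indecomposable direct summand having a Sylow `p`-subgroup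
of `G` as a vertex. -/
def HasSylowVertexComponent (p : ℕ) {V : Type u} [AddCommGroup V] [Module k V]
    (ρ : Representation k G V) : Prop :=
  ∃ (U : Type u) (_ : AddCommGroup U) (_ : Module k U) (σ : Representation k G U),
    IsIndecomposable σ ∧ IsSummand σ ρ ∧ ∃ S : Sylow p G, IsVertex (S : Subgroup G) σ

/-- Dade modules: finitely generated modules `M` with `End M ≅ k ^ n ⊕ W` for some `n ≥ 0` and some
`p`-permutation module `W` without Sylow-vertex components. The group acts on `End M` by
conjugation. -/
def IsDade (p : ℕ) {V : Type u} [AddCommGroup V] [Module k V]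
    (ρ : Representation k G V) : Prop :=
  Module.Finite k V ∧
  ∃ (n : ℕ) (W : Type u) (_ : AddCommGroup W) (_ : Module k W) (τ : Representation k G W),
    IsPPermutation τ ∧ ¬ HasSylowVertexComponent p τ ∧
    Nonempty ((ρ.linHom ρ).Equiv ((Representation.trivial k G (Fin n → k)).prod τ))

/-- A Dade module is capped if it has a Sylow-vertex component. -/
def IsCappedDade (p : ℕ) {V : Type u} [AddCommGroup V] [Module k V]
    (ρ : Representation k G V) : Prop :=
  IsDade p ρ ∧ HasSylowVertexComponent p ρ

end DadeModules

section DadeGroup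

variable (k : Type u) [Field k] (G : Type v) [Group G] (p : ℕ)

/-- The collection of all capped Dade `kG`-modules. -/
structure CappedDadeModule where
  carrier : Type u
  [addCommGroup : AddCommGroup carrier]
  [module : Module k carrier]
  ρ : Representation k G carrier
  isCappedDade : IsCappedDade p ρ

attribute [instance] CappedDadeModule.addCommGroup CappedDadeModule.module

variable {k G p} in
/-- Two capped Dade modules are compatible if their direct sum is a Dade module. -/
def Compatible (M N : CappedDadeModule k G p) : Prop :=
  IsDade p (M.ρ.prod N.ρ)

/-- The underlying set of the Dade group `D(G)`: capped Dade modules modulo compatibility. -/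
def DadeGroup : Type (max (u + 1) v) :=
  Quot (Compatible (k := k) (G := G) (p := p))

variable {k G p} in
/-- The class `[ρ] ∈ D(G)` of a capped Dade module. -/
def DadeGroup.mk {V : Type u} [AddCommGroup V] [Module k V] (ρ : Representation k G V)
    (h : IsCappedDade p ρ) : DadeGroup k G p :=
  Quot.mk _ ⟨V, ρ, h⟩

end DadeGroup

/-! ### Finite `G`-sets, relative syzygies and superclass functions -/

/-- Non-empty finite `G`-sets. -/
structure FinGSet (G : Type v) [Group G] where
  carrier : Type u
  [mulAction : MulAction G carrier]
  [finite : Finite carrier]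
  [nonempty : Nonempty carrier]

attribute [instance] FinGSet.mulAction FinGSet.finite FinGSet.nonempty

section GSets

variable {G : Type v} [Group G]

/-- `X ^ P ≠ ∅`: some point of the `G`-set `X` is fixed by all elements of the subgroup `P`. -/
def HasFixedPoint (P : Subgroup G) (X : FinGSet.{u} G) : Prop :=
  (MulAction.fixedPoints P X.carrier).Nonempty

/-- The augmentation map `kX → k`, `∑ c_x x ↦ ∑ c_x`. -/
noncomputable def augmentation (k : Type u) [Field k] (X : FinGSet.{u} G) :
    IntertwiningMap (ofMulAction k G X.carrier) (Representation.trivial k G k) where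
  toLinearMap := Finsupp.linearCombination k (fun _ : X.carrier => (1 : k)) ∘ₗ
    (MonoidAlgebra.coeffLinearEquiv k).toLinearMap
  isIntertwining' g := by ext x; simp

/-- The relative syzygy `Δ(X)`: the kernel of the augmentation map `kX → k`. -/
noncomputable def relSyzygy (k : Type u) [Field k] (X : FinGSet.{u} G) :
    Representation k G (augmentation k X).ker.toSubmodule :=
  (augmentation k X).ker.toRepresentation

variable (G) in
/-- The group `C(G, p)` of superclass functions: integer-valued functions on the `p`-subgroups of
`G`, constant on `G`-conjugacy classes, under pointwise addition. -/
def Superclass (p : ℕ) : AddSubgroup ({P : Subgroup G // IsPGroup p P} → ℤ) where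
  carrier := {f | ∀ (P Q : {P : Subgroup G // IsPGroup p P}) (g : G),
    Q.1 = P.1.map (MulAut.conj g).toMonoidHom → f Q = f P}
  zero_mem' := fun _ _ _ _ => rfl
  add_mem' := fun ha hb P Q g h => by simp [ha P Q g h, hb P Q g h]
  neg_mem' := fun ha P Q g h => by simp [ha P Q g h]

open Classical in
/-- The superclass function `ω_X`, with `ω_X(P) = 1` if `X ^ P ≠ ∅` and `ω_X(P) = 0` otherwise. -/
noncomputable def omega (p : ℕ) (X : FinGSet.{u} G) : Superclass G p :=
  ⟨fun P => if HasFixedPoint P.1 X then 1 else 0, by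
    rintro ⟨P, hP⟩ ⟨Q, hQ⟩ g h
    have key : HasFixedPoint Q X ↔ HasFixedPoint P X := by
      obtain rfl : Q = P.map (MulAut.conj g).toMonoidHom := h
      constructor
      · rintro ⟨x, hx⟩
        refine ⟨g⁻¹ • x, fun a => ?_⟩
        have := hx ⟨g * a * g⁻¹, a, a.2, by simp⟩
        simp only [Subgroup.smul_def] at this ⊢
        rw [eq_inv_smul_iff, smul_smul, smul_smul]
        exact this
      · rintro ⟨x, hx⟩
        refine ⟨g • x, ?_⟩
        rintro ⟨_, a, ha, rfl⟩
        have := hx ⟨a, ha⟩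
        simp only [Subgroup.smul_def] at this ⊢
        simp [mul_smul, this]
    simp only [key]⟩

end GSets

end Dade

/-! Fix a Sylow subgroup `S` and call a finite `G`-set tame if its `S`-fixed points are `G`-fixed.
The central fact (`isDade_iff`) is that a finitely generated `M` is a Dade module exactly when `End
M` is a direct summand of a permutation module on a tame `G`-set. It rests on two points. A finitely
generated module has no Sylow-vertex component iff it is projective relative to a `G`-set without
`S`-fixed points (`hasSylowVertexComponent_iff`). A summand of a tame permutation module is `k ^ n`
plus a `p`-permutation module of that kind (`HasTameFrame.exists_equiv`).

Tame sets are stable under disjoint unions and products. Hence the same condition on `Hom(M, N)`,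
called `IsTamePair`, is symmetric and passes to summands, tensor products and duals; between capped
Dade modules it is compatibility. A Dade module is capped iff it has an equivariant endomorphism of
nonzero trace. Such an endomorphism of `N` makes `Hom(M, L)` a summand of `Hom(M, N) ⊗ Hom(N, L)`,
whence transitivity. The inverse of `[M]` is the class of the dual, because `M* ⊗ M ≅ End M`.

If the same `p`-subgroups have fixed points on `X` and `Y`, averaging `S`-maps over `G / S` gives
equivariant weights in both directions, and these make `Δ(X)` and `Δ(Y)` compatible
(`isTamePair_syz`). So `Ω_X` depends only on `ω_X`. An explicit splitting of `Δ(X) ⊗ Δ(Y)` off `Δ(X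
× Y) ⊗ Δ(X ⊔ Y)` (`isSummand_syz_syz`) yields `Ω_X + Ω_Y = Ω_{X ⊔ Y} + Ω_{X × Y}`. Supports of the
`ω_X` are exactly the non-empty families of `p`-subgroups closed under subconjugation, with union
and intersection given by `X ⊔ Y` and `X × Y`. Thus `Ω` is a valuation on the lower sets of a finite
poset, and a valuation extends additively to all integer functions
(`exists_addMonoidHom_of_valuation`). The image contains the generators `Ω_X`, so the homomorphism
is onto. -/

namespace Dade

open scoped TensorProduct

/-! ### Relative projectivity with respect to a `G`-set -/

section RelProj

variable {k : Type*} [Field k] {G : Type*} [Group G]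
  {V : Type*} [AddCommGroup V] [Module k V] {W : Type*} [AddCommGroup W] [Module k W]

/-- Relative projectivity with respect to the permutation module on `X`, by a Higman type
criterion: the identity of `V` is the sum of an equivariant family of endomorphisms. -/
def IsRelProjOn (X : Type*) [Fintype X] [MulAction G X] (ρ : Representation k G V) : Prop :=
  ∃ θ : X → V →ₗ[k] V, (∀ g x v, θ (g • x) (ρ g v) = ρ g (θ x v)) ∧ ∀ v, ∑ x, θ x v = v

theorem IsRelProjOn.map {X Y : Type*} [Fintype X] [MulAction G X] [Fintype Y] [MulAction G Y]
    {ρ : Representation k G V} (h : IsRelProjOn X ρ) (f : X → Y)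
    (hf : ∀ (g : G) x, f (g • x) = g • f x) : IsRelProjOn Y ρ := by
  classical
  obtain ⟨θ, hθ, hs⟩ := h
  refine ⟨fun y => ∑ x with f x = y, θ x, fun g y v => ?_, fun v => ?_⟩
  · simp only [LinearMap.sum_apply, map_sum]
    symm
    refine Finset.sum_bij (fun x _ => g • x) ?_ ?_ ?_ ?_
    · intro x hx
      simp only [Finset.mem_filter, Finset.mem_univ, true_and] at hx ⊢
      rw [hf, hx]
    · intro a _ b _ hab
      exact MulAction.injective g hab
    · intro x hx
      simp only [Finset.mem_filter, Finset.mem_univ, true_and] at hx ⊢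
      exact ⟨g⁻¹ • x, by rw [hf, hx, inv_smul_smul], smul_inv_smul g x⟩
    · intro x _
      rw [hθ]
  · simp only [LinearMap.sum_apply]
    rw [Finset.sum_fiberwise Finset.univ f fun x => θ x v, hs]

theorem IsRelProjOn.of_isSummand {X : Type*} [Fintype X] [MulAction G X]
    {ρ : Representation k G V} {σ : Representation k G W} (h : IsRelProjOn X ρ)
    (hs : IsSummand σ ρ) : IsRelProjOn X σ := by
  obtain ⟨θ, hθ, hsum⟩ := h
  obtain ⟨i, r, hir⟩ := hs
  refine ⟨fun x => r.toLinearMap ∘ₗ θ x ∘ₗ i.toLinearMap, fun g x v => ?_, fun v => ?_⟩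
  · simp [i.isIntertwining, r.isIntertwining, hθ]
  · simp only [LinearMap.comp_apply, IntertwiningMap.coe_toLinearMap]
    rw [← IntertwiningMap.coe_toLinearMap, ← map_sum, hsum]
    exact congrArg (fun f : IntertwiningMap σ σ => f v) hir

theorem IsRelProjOn.prod {X : Type*} [Fintype X] [MulAction G X]
    {ρ : Representation k G V} {σ : Representation k G W} (h : IsRelProjOn X ρ)
    (h' : IsRelProjOn X σ) : IsRelProjOn X (ρ.prod σ) := by
  obtain ⟨θ, hθ, hs⟩ := h
  obtain ⟨θ', hθ', hs'⟩ := h'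
  refine ⟨fun x => (θ x).prodMap (θ' x), fun g x v => ?_, fun v => ?_⟩
  · simp [hθ, hθ']
  · refine Prod.ext ?_ ?_
    · simp [Prod.fst_sum, hs]
    · simp [Prod.snd_sum, hs']

theorem IsSummand.refl (ρ : Representation k G V) : IsSummand ρ ρ :=
  ⟨IntertwiningMap.id ρ, IntertwiningMap.id ρ, by ext; simp⟩

theorem IsSummand.trans {U : Type*} [AddCommGroup U] [Module k U] {τ : Representation k G U}
    {ρ : Representation k G V} {σ : Representation k G W} (h : IsSummand τ σ)
    (h' : IsSummand σ ρ) : IsSummand τ ρ := by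
  obtain ⟨i, r, hir⟩ := h
  obtain ⟨j, s, hjs⟩ := h'
  refine ⟨j.comp i, r.comp s, ?_⟩
  have h1 : ∀ v, s (j v) = v := fun v => congrArg (fun f : IntertwiningMap σ σ => f v) hjs
  have h2 : ∀ v, r (i v) = v := fun v => congrArg (fun f : IntertwiningMap τ τ => f v) hir
  ext v
  simp [h1, h2]

theorem IsSummand.of_maps {ρ : Representation k G V} {σ : Representation k G W}
    (i : V →ₗ[k] W) (r : W →ₗ[k] V) (hi : ∀ g v, i (ρ g v) = σ g (i v))
    (hr : ∀ g w, r (σ g w) = ρ g (r w)) (hir : ∀ v, r (i v) = v) : IsSummand ρ σ :=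
  ⟨i.intertwiningMap_of_isIntertwiningMap _ _ hi, r.intertwiningMap_of_isIntertwiningMap _ _ hr,
    by ext v; exact hir v⟩

theorem IsSummand.exists_maps {ρ : Representation k G V} {σ : Representation k G W}
    (h : IsSummand ρ σ) : ∃ (i : V →ₗ[k] W) (r : W →ₗ[k] V), (∀ g v, i (ρ g v) = σ g (i v)) ∧
      (∀ g w, r (σ g w) = ρ g (r w)) ∧ ∀ v, r (i v) = v := by
  obtain ⟨i, r, hir⟩ := h
  exact ⟨i.toLinearMap, r.toLinearMap, i.isIntertwining, r.isIntertwining,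
    fun v => congrArg (fun f : IntertwiningMap ρ ρ => f v) hir⟩

theorem IsSummand.of_equiv {ρ : Representation k G V} {σ : Representation k G W}
    (e : ρ.Equiv σ) : IsSummand ρ σ :=
  IsSummand.of_maps e.toLinearMap e.symm.toLinearMap e.toIntertwiningMap.isIntertwining
    e.symm.toIntertwiningMap.isIntertwining fun v => e.toLinearEquiv.symm_apply_apply v

theorem IsSummand.finite {ρ : Representation k G V} {σ : Representation k G W}
    (h : IsSummand ρ σ) [Module.Finite k W] : Module.Finite k V := by
  obtain ⟨i, r, -, -, hir⟩ := h.exists_maps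
  exact Module.Finite.of_surjective r fun v => ⟨i v, hir v⟩

/-- The criterion `IsRelProjOn` for the `G`-set of cosets of a subgroup. -/
theorem isRelProjective_iff [Finite G] (K : Subgroup G) [Fintype (G ⧸ K)]
    (ρ : Representation k G V) : IsRelProjective K ρ ↔ IsRelProjOn (G ⧸ K) ρ := by
  classical
  have hmk : ∀ (κ : K) (h : G) (a : V), IndV.mk K.subtype (res K ρ) ((κ : G) * h) (ρ κ a) =
      IndV.mk K.subtype (res K ρ) h a := by
    intro κ h a
    have := Coinvariants.mk_self_apply (Representation.tprod ((leftRegular k G).comp K.subtype)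
      (res K ρ)) κ (MonoidAlgebra.single h 1 ⊗ₜ a)
    simpa using this
  constructor
  · intro h
    refine IsRelProjOn.of_isSummand ?_ h
    -- In the coinvariant model `g` sends the class of `h ⊗ a` to that of `h g⁻¹ ⊗ a`. The block of
    -- the induced module at the coset `c` is therefore spanned by the classes with `h⁻¹ ∈ c`, and
    -- `φ c` projects onto it.
    let φ : G ⧸ K → (TensorProduct k (MonoidAlgebra k G) V) →ₗ[k] IndV K.subtype (res K ρ) :=
      fun c => TensorProduct.lift
        ((Finsupp.lsum k fun h => LinearMap.toSpanSingleton k _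
          (if (QuotientGroup.mk h⁻¹ : G ⧸ K) = c then IndV.mk K.subtype (res K ρ) h else 0)) ∘ₗ
          (MonoidAlgebra.coeffLinearEquiv k).toLinearMap)
    have hφ : ∀ c h a, φ c (MonoidAlgebra.single h 1 ⊗ₜ a) =
        if (QuotientGroup.mk h⁻¹ : G ⧸ K) = c then IndV.mk K.subtype (res K ρ) h a else 0 := by
      intro c h a
      simp only [φ, TensorProduct.lift.tmul]
      split_ifs with hc <;> simp [hc]
    have hcos : ∀ (κ : K) (h : G), (QuotientGroup.mk ((κ : G) * h)⁻¹ : G ⧸ K) =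
        QuotientGroup.mk h⁻¹ := by
      intro κ h
      rw [QuotientGroup.eq]
      simp
    let θ : G ⧸ K → IndV K.subtype (res K ρ) →ₗ[k] IndV K.subtype (res K ρ) := fun c =>
      Coinvariants.lift _ (φ c) (by
        intro κ
        refine TensorProduct.ext (MonoidAlgebra.lhom_ext' fun h => LinearMap.ext_ring ?_)
        ext a
        have h1 := hφ c (κ * h) (ρ κ a)
        have h2 := hφ c h a
        rw [hcos, hmk] at h1
        simpa using h1.trans h2.symm)
    have hθ : ∀ c h a, θ c (IndV.mk _ _ h a) =
        if (QuotientGroup.mk h⁻¹ : G ⧸ K) = c then IndV.mk K.subtype (res K ρ) h a else 0 :=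
      fun c h a => hφ c h a
    refine ⟨θ, fun g c v => ?_, fun v => ?_⟩
    · have : θ (g • c) ∘ₗ (ind K.subtype (res K ρ) g) = (ind K.subtype (res K ρ) g) ∘ₗ θ c := by
        refine IndV.hom_ext _ _ fun h => LinearMap.ext fun a => ?_
        change θ (g • c) (ind K.subtype (res K ρ) g (IndV.mk K.subtype (res K ρ) h a)) =
          ind K.subtype (res K ρ) g (θ c (IndV.mk K.subtype (res K ρ) h a))
        rw [ind_mk, hθ, hθ]
        have hc : ((QuotientGroup.mk (h * g⁻¹)⁻¹ : G ⧸ K) = g • c) ↔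
            ((QuotientGroup.mk h⁻¹ : G ⧸ K) = c) := by
          rw [mul_inv_rev, inv_inv]
          exact smul_left_cancel_iff g (x := (QuotientGroup.mk h⁻¹ : G ⧸ K))
        by_cases h' : (QuotientGroup.mk h⁻¹ : G ⧸ K) = c
        · rw [if_pos h', if_pos (hc.2 h'), ind_mk]
        · rw [if_neg h', if_neg (fun h => h' (hc.1 h)), map_zero]
      exact LinearMap.congr_fun this v
    · have : ∑ c, θ c = LinearMap.id := by
        refine IndV.hom_ext _ _ fun h => LinearMap.ext fun a => ?_
        change (∑ c, θ c) (IndV.mk K.subtype (res K ρ) h a) = IndV.mk K.subtype (res K ρ) h a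
        rw [LinearMap.sum_apply, Finset.sum_congr rfl fun c _ => hθ c h a]
        simp
      rw [← LinearMap.sum_apply, this, LinearMap.id_apply]
  · rintro ⟨θ, hθ, hs⟩
    have hwd : ∀ g h : G, (QuotientGroup.mk g : G ⧸ K) = QuotientGroup.mk h → ∀ v,
        IndV.mk K.subtype (res K ρ) g⁻¹ (ρ g⁻¹ v) = IndV.mk K.subtype (res K ρ) h⁻¹ (ρ h⁻¹ v) := by
      intro g h hgh v
      rw [QuotientGroup.eq] at hgh
      have := hmk ⟨_, hgh⟩ h⁻¹ (ρ h⁻¹ v)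
      rw [← Module.End.mul_apply, ← map_mul] at this
      simpa using this
    let r₀ : (TensorProduct k (MonoidAlgebra k G) V) →ₗ[k] V := TensorProduct.lift
        ((Finsupp.lsum k fun h => LinearMap.toSpanSingleton k _
          (θ (QuotientGroup.mk h⁻¹) ∘ₗ ρ h⁻¹)) ∘ₗ
          (MonoidAlgebra.coeffLinearEquiv k).toLinearMap)
    have hr₀ : ∀ h a, r₀ (MonoidAlgebra.single h 1 ⊗ₜ a) =
        θ (QuotientGroup.mk h⁻¹) (ρ h⁻¹ a) := by
      intro h a
      simp [r₀]
    let r : IndV K.subtype (res K ρ) →ₗ[k] V := Coinvariants.lift _ r₀ (by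
        intro κ
        refine TensorProduct.ext (MonoidAlgebra.lhom_ext' fun h => LinearMap.ext_ring ?_)
        ext a
        have h1 := hr₀ (κ * h) (ρ κ a)
        have h2 := hr₀ h a
        have h3 : (QuotientGroup.mk ((κ : G) * h)⁻¹ : G ⧸ K) = QuotientGroup.mk h⁻¹ := by
          rw [QuotientGroup.eq]; simp
        rw [h3, ← Module.End.mul_apply (ρ ((κ : G) * h)⁻¹), ← map_mul] at h1
        simp only [mul_inv_rev, inv_mul_cancel_right] at h1
        simpa using h1.trans h2.symm)
    have hr : ∀ h a, r (IndV.mk _ _ h a) = θ (QuotientGroup.mk h⁻¹) (ρ h⁻¹ a) := hr₀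
    -- The section is `v ↦ ∑ c⁻¹ ⊗ c⁻¹ v` over coset representatives, independent of their choice by
    -- `hwd`. Applying `r` to it returns `∑ θ c v = v`.
    refine IsSummand.of_maps
      (∑ c : G ⧸ K, IndV.mk K.subtype (res K ρ) c.out⁻¹ ∘ₗ ρ c.out⁻¹) r ?_ ?_ ?_
    · intro g v
      simp only [LinearMap.sum_apply, map_sum, LinearMap.comp_apply (IndV.mk _ _ _)]
      symm
      refine Fintype.sum_equiv (MulAction.toPerm g) _ _ fun c => ?_
      rw [ind_mk]
      have h1 := hwd ((g • c).out) (g * c.out)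
        (by rw [QuotientGroup.out_eq']; conv_lhs => rw [← QuotientGroup.out_eq' c]
            rfl) (ρ g v)
      rw [MulAction.toPerm_apply, h1, ← Module.End.mul_apply (ρ (g * c.out)⁻¹), ← map_mul]
      simp
    · intro g w
      have : r ∘ₗ (ind K.subtype (res K ρ) g) = ρ g ∘ₗ r := by
        refine IndV.hom_ext _ _ fun h => LinearMap.ext fun a => ?_
        change r (ind K.subtype (res K ρ) g (IndV.mk K.subtype (res K ρ) h a)) =
          ρ g (r (IndV.mk K.subtype (res K ρ) h a))
        rw [ind_mk, hr, hr, ← hθ, mul_inv_rev, inv_inv, map_mul]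
        rfl
      exact LinearMap.congr_fun this w
    · intro v
      simp only [LinearMap.sum_apply, map_sum, LinearMap.comp_apply (IndV.mk _ _ _), hr]
      simp only [inv_inv, QuotientGroup.out_eq', self_inv_apply, hs]

end RelProj

/-! ### Endomorphisms of indecomposable modules -/

section Fitting

variable {k : Type*} [Field k] {G : Type*} [Group G]
  {V : Type*} [AddCommGroup V] [Module k V] [Module.Finite k V]

/-- Fitting's lemma for indecomposable representations. -/
theorem IsIndecomposable.isUnit_or_isNilpotent {ρ : Representation k G V}
    (h : IsIndecomposable ρ) (f : Module.End k V) (hf : ∀ g v, f (ρ g v) = ρ g (f v)) :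
    IsUnit f ∨ IsNilpotent f := by
  obtain ⟨n, hn⟩ := Filter.eventually_atTop.1 (LinearMap.eventually_isCompl_ker_pow_range_pow f)
  have hc := hn (n + 1) n.le_succ
  have hp : ∀ m g v, (f ^ m) (ρ g v) = ρ g ((f ^ m) v) := by
    intro m g
    induction m with
    | zero => simp
    | succ m ih => intro v; rw [pow_succ, Module.End.mul_apply, Module.End.mul_apply, hf, ih]
  let A : Subrepresentation ρ := ⟨LinearMap.ker (f ^ (n + 1)), fun g v hv => by
    rw [LinearMap.mem_ker] at hv ⊢; rw [hp, hv, map_zero]⟩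
  let B : Subrepresentation ρ := ⟨LinearMap.range (f ^ (n + 1)), by
    rintro g _ ⟨v, rfl⟩; exact ⟨ρ g v, hp _ _ _⟩⟩
  rcases h.2 A B hc with hA | hB
  · left
    have hA' : LinearMap.ker (f ^ (n + 1)) = ⊥ := hA
    have := (LinearMap.isUnit_iff_ker_eq_bot _).2 hA'
    exact (isUnit_pow_iff n.succ_ne_zero).1 this
  · right
    exact ⟨n + 1, LinearMap.range_eq_bot.1 hB⟩

/-- The equivariant endomorphisms form a local ring. Once the sum is normalised to 1, a non-unit
term is nilpotent, so the other terms still add up to a unit. -/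
theorem IsIndecomposable.exists_isUnit_of_sum {ρ : Representation k G V}
    (h : IsIndecomposable ρ) {ι : Type*} (s : Finset ι) (f : ι → Module.End k V)
    (hf : ∀ i g v, f i (ρ g v) = ρ g (f i v)) (hu : IsUnit (∑ i ∈ s, f i)) :
    ∃ i ∈ s, IsUnit (f i) := by
  classical
  induction s using Finset.induction_on with
  | empty =>
    have := h.1
    simp at hu
  | insert a s ha ih =>
    by_cases hfa : IsUnit (f a)
    · exact ⟨a, by simp, hfa⟩
    rw [Finset.sum_insert ha] at hu
    obtain ⟨w, hw⟩ := hu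
    have hwc : ∀ g v, (↑w⁻¹ : Module.End k V) (ρ g v) = ρ g ((↑w⁻¹ : Module.End k V) v) := by
      intro g v
      have h1 : ∀ v, (w : Module.End k V) (ρ g v) = ρ g ((w : Module.End k V) v) := by
        intro v
        rw [hw]
        simp [hf]
      have h2 : ∀ v, (w : Module.End k V) ((↑w⁻¹ : Module.End k V) v) = v := fun v => by
        rw [← Module.End.mul_apply, w.mul_inv]; rfl
      have h3 : ∀ v, (↑w⁻¹ : Module.End k V) ((w : Module.End k V) v) = v := fun v => by
        rw [← Module.End.mul_apply, w.inv_mul]; rfl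
      conv_lhs => rw [← h2 v, ← h1, h3]
    have hnil : IsNilpotent ((↑w⁻¹ : Module.End k V) * f a) := by
      refine (h.isUnit_or_isNilpotent _ fun g v => ?_).resolve_left fun hu => hfa ?_
      · rw [Module.End.mul_apply, hf, hwc]; rfl
      · rwa [Units.isUnit_units_mul] at hu
    have h1 : (↑w⁻¹ : Module.End k V) * ∑ i ∈ s, f i = 1 - (↑w⁻¹ : Module.End k V) * f a := by
      rw [eq_sub_iff_add_eq', ← mul_add, ← hw, w.inv_mul]
    have h2 := hnil.isUnit_one_sub
    rw [← h1, Units.isUnit_units_mul] at h2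
    obtain ⟨i, hi, hi'⟩ := ih h2
    exact ⟨i, by simp [hi], hi'⟩

end Fitting

/-! ### Sylow vertices and `G`-sets without Sylow-fixed points -/

section Sylow

variable {k : Type*} [Field k] {G : Type*} [Group G] {p : ℕ}
  {V : Type*} [AddCommGroup V] [Module k V] {W : Type*} [AddCommGroup W] [Module k W]

/-- Projectivity relative to some finite `G`-set without fixed points under `S`. -/
def IsProjWithoutFixed (S : Subgroup G) (ρ : Representation k G V) : Prop :=
  ∃ (n : ℕ) (_ : MulAction G (Fin n)), (∀ x : Fin n, x ∉ MulAction.fixedPoints S (Fin n)) ∧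
    IsRelProjOn (Fin n) ρ

/-- Transport of an action on a finite type to an initial segment of `ℕ`. -/
theorem exists_fin_action (X : Type*) [Finite X] [MulAction G X] :
    ∃ (n : ℕ) (_ : MulAction G (Fin n)) (e : X ≃ Fin n), ∀ (g : G) x, e (g • x) = g • e x := by
  obtain ⟨n, ⟨e⟩⟩ := Finite.exists_equiv_fin X
  refine ⟨n, e.symm.mulAction G, e, fun g x => ?_⟩
  let _ := e.symm.mulAction G
  simp [Equiv.smul_def]

theorem IsProjWithoutFixed.intro {S : Subgroup G} {ρ : Representation k G V} (X : Type*)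
    [Fintype X] [MulAction G X] (hX : ∀ x : X, x ∉ MulAction.fixedPoints S X)
    (h : IsRelProjOn X ρ) : IsProjWithoutFixed S ρ := by
  obtain ⟨n, inst, e, he⟩ := exists_fin_action (G := G) X
  refine ⟨n, inst, fun x hx => hX (e.symm x) fun s => e.injective ?_, h.map e he⟩
  have := hx s
  rw [Subgroup.smul_def] at this ⊢
  rw [he, e.apply_symm_apply, this]

theorem IsProjWithoutFixed.of_isSummand {S : Subgroup G} {ρ : Representation k G V}
    {σ : Representation k G W} (h : IsProjWithoutFixed S ρ) (hs : IsSummand σ ρ) :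
    IsProjWithoutFixed S σ := by
  obtain ⟨n, inst, hn, hr⟩ := h
  exact ⟨n, inst, hn, hr.of_isSummand hs⟩

theorem IsProjWithoutFixed.prod {S : Subgroup G} {ρ : Representation k G V}
    {σ : Representation k G W} (h : IsProjWithoutFixed S ρ) (h' : IsProjWithoutFixed S σ) :
    IsProjWithoutFixed S (ρ.prod σ) := by
  obtain ⟨n, inst, hn, hr⟩ := h
  obtain ⟨m, inst', hm, hr'⟩ := h'
  refine IsProjWithoutFixed.intro (Fin n ⊕ Fin m) ?_
    ((hr.map Sum.inl fun _ _ => rfl).prod (hr'.map Sum.inr fun _ _ => rfl))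
  rintro (x | x) hx
  · exact hn x fun s => Sum.inl_injective (hx s)
  · exact hm x fun s => Sum.inr_injective (hx s)

theorem exists_fixedPoint_of_sylow [Finite G] [Fact p.Prime] (S T : Sylow p G) {X : Type*}
    [MulAction G X] {x : X} (hx : x ∈ MulAction.fixedPoints (T : Subgroup G) X) :
    ∃ y : X, y ∈ MulAction.fixedPoints (S : Subgroup G) X := by
  obtain ⟨g, rfl⟩ := MulAction.exists_smul_eq G T S
  refine ⟨g • x, ?_⟩
  rintro ⟨s, hs⟩
  rw [Sylow.coe_subgroup_smul, Subgroup.mem_pointwise_smul_iff_inv_smul_mem] at hs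
  have := hx ⟨_, hs⟩
  rw [Subgroup.smul_def] at this ⊢
  simp only [← map_inv, MulAut.smul_def, MulAut.conj_apply, inv_inv] at this ⊢
  rw [← inv_smul_eq_iff, smul_smul, smul_smul, this]

theorem index_cast_ne_zero [Finite G] [Fact p.Prime] [CharP k p] (S : Sylow p G) :
    ((S : Subgroup G).index : k) ≠ 0 := by
  rw [Ne, CharP.cast_eq_zero_iff k p]
  exact S.not_dvd_index

/-- Every representation is projective relative to a Sylow subgroup. -/
theorem IsRelProjOn.prod_sylow [Finite G] [Fact p.Prime] [CharP k p] (S : Sylow p G)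
    [Fintype (G ⧸ (S : Subgroup G))] {X : Type*} [Fintype X] [MulAction G X]
    {ρ : Representation k G V} (h : IsRelProjOn X ρ) :
    IsRelProjOn (X × (G ⧸ (S : Subgroup G))) ρ := by
  obtain ⟨θ, hθ, hs⟩ := h
  refine ⟨fun x => ((S : Subgroup G).index : k)⁻¹ • θ x.1, fun g x v => ?_, fun v => ?_⟩
  · simp [hθ]
  · simp only [LinearMap.smul_apply]
    rw [← Finset.smul_sum, Fintype.sum_prod_type]
    simp only [Finset.sum_const, Finset.card_univ, ← Finset.smul_sum, hs]
    rw [← Nat.card_eq_fintype_card, ← Subgroup.index_eq_card, ← Nat.cast_smul_eq_nsmul k, smul_smul,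
      inv_mul_cancel₀ (index_cast_ne_zero S), one_smul]

theorem IsRelProjOn.of_unique {X : Type*} [Fintype X] [Unique X] [MulAction G X]
    (ρ : Representation k G V) : IsRelProjOn X ρ :=
  ⟨fun _ => LinearMap.id, fun _ _ _ => rfl, fun v => by simp⟩

theorem isRelProjOn_sylow [Finite G] [Fact p.Prime] [CharP k p] (S : Sylow p G)
    [Fintype (G ⧸ (S : Subgroup G))] (ρ : Representation k G V) :
    IsRelProjOn (G ⧸ (S : Subgroup G)) ρ :=
  let _ : MulAction G Unit :=
    { smul := fun _ x => x, one_smul := fun _ => rfl, mul_smul := fun _ _ _ => rfl }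
  ((IsRelProjOn.of_unique (X := Unit) ρ).prod_sylow S).map Prod.snd fun _ _ => rfl

/-- After multiplying the `G`-set by `G / T`, the family sums over each orbit to an equivariant
endomorphism, and one of these is invertible. The module is then projective relative to a point
stabilizer of that orbit; minimality of the vertex `T` forces `T` to fix the point, so `S` has a
fixed point by Sylow conjugacy. -/
theorem IsIndecomposable.not_isProjWithoutFixed [Finite G] [Fact p.Prime] [CharP k p]
    [Module.Finite k V] {ρ : Representation k G V} (h : IsIndecomposable ρ) (S T : Sylow p G)
    (hT : IsVertex (T : Subgroup G) ρ) : ¬ IsProjWithoutFixed (S : Subgroup G) ρ := by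
  classical
  rintro ⟨n, inst, hn, hr⟩
  have : Fintype (G ⧸ (T : Subgroup G)) := Fintype.ofFinite _
  obtain ⟨θ, hθ, hs⟩ := hr.prod_sylow T
  let X := Fin n × (G ⧸ (T : Subgroup G))
  let q : X → Quotient (MulAction.orbitRel G X) := Quotient.mk _
  have hq : ∀ (g : G) (x : X), q (g • x) = q x := fun g x => Quotient.sound ⟨g, rfl⟩
  let α : Quotient (MulAction.orbitRel G X) → Module.End k V := fun ω => ∑ x with q x = ω, θ x
  have hα : ∀ ω g v, α ω (ρ g v) = ρ g (α ω v) := by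
    intro ω g v
    simp only [α, LinearMap.sum_apply, map_sum]
    symm
    refine Finset.sum_bij (fun x _ => g • x) ?_ ?_ ?_ ?_
    · intro x hx
      simp only [Finset.mem_filter, Finset.mem_univ, true_and] at hx ⊢
      rw [hq, hx]
    · intro a _ b _ hab
      exact MulAction.injective g hab
    · intro x hx
      simp only [Finset.mem_filter, Finset.mem_univ, true_and] at hx ⊢
      exact ⟨g⁻¹ • x, by rw [hq, hx], smul_inv_smul g x⟩
    · intro x _
      rw [hθ]
  have hsum : ∑ ω, α ω = 1 := by
    simp only [α]
    rw [Finset.sum_fiberwise Finset.univ q θ]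
    ext v
    rw [LinearMap.sum_apply]
    exact hs v
  obtain ⟨ω, -, hω⟩ := h.exists_isUnit_of_sum Finset.univ α hα (by rw [hsum]; exact isUnit_one)
  obtain ⟨⟨y, hy⟩, hyω⟩ : ∃ x : X, q x = ω := Quotient.exists_rep ω
  obtain ⟨g, rfl⟩ := QuotientGroup.mk_surjective hy
  -- The orbit meets the fibre over the trivial coset. A point there has stabilizer inside `T`, as
  -- the minimality of the vertex requires.
  let x : X := (g⁻¹ • y, ((1 : G) : G ⧸ (T : Subgroup G)))
  have hxω : q x = ω := by
    rw [← hyω, ← hq g x]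
    refine congrArg q (Prod.ext (smul_inv_smul g y) ?_)
    change ((g * 1 : G) : G ⧸ (T : Subgroup G)) = g
    rw [mul_one]
  let K := MulAction.stabilizer G x
  have hKT : K ≤ T := by
    intro s hs
    have h1 : s • ((1 : G) : G ⧸ (T : Subgroup G)) = ((1 : G) : G ⧸ (T : Subgroup G)) :=
      congrArg Prod.snd hs
    have h2 : ((s * 1 : G) : G ⧸ (T : Subgroup G)) = ((1 : G) : G ⧸ (T : Subgroup G)) := h1
    rw [eq_comm, QuotientGroup.eq] at h2
    simpa using h2
  have : Fintype (G ⧸ K) := Fintype.ofFinite _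
  have hK : IsRelProjective K ρ := by
    rw [isRelProjective_iff]
    obtain ⟨w, hw⟩ := hω
    have h2 : ∀ v, (w : Module.End k V) ((↑w⁻¹ : Module.End k V) v) = v := fun v => by
      rw [← Module.End.mul_apply, w.mul_inv]; rfl
    have h3 : ∀ v, (↑w⁻¹ : Module.End k V) ((w : Module.End k V) v) = v := fun v => by
      rw [← Module.End.mul_apply, w.inv_mul]; rfl
    -- The family over the chosen orbit has sum `w`; composing with the equivariant map `w⁻¹` makes
    -- it sum to the identity.
    refine ⟨fun c => (↑w⁻¹ : Module.End k V) ∘ₗ θ (MulAction.ofQuotientStabilizer G x c),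
      fun g c v => ?_, fun v => ?_⟩
    · have hsm := MulAction.ofQuotientStabilizer_smul G x g c
      refine (congrArg (fun z => (↑w⁻¹ : Module.End k V) (θ z (ρ g v))) hsm).trans ?_
      simp only [LinearMap.comp_apply, hθ]
      conv_rhs => rw [← h3 (ρ g _), hw, hα, ← hw, h2]
    · simp only [LinearMap.comp_apply, ← map_sum]
      conv_rhs => rw [← h3 v]
      congr 1
      rw [hw]
      simp only [α, LinearMap.sum_apply]
      refine Finset.sum_bij (fun c _ => MulAction.ofQuotientStabilizer G x c) ?_ ?_ ?_ ?_
      · intro c _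
        obtain ⟨g, rfl⟩ := QuotientGroup.mk_surjective c
        simp only [Finset.mem_filter, Finset.mem_univ, true_and]
        rw [MulAction.ofQuotientStabilizer_mk, hq, hxω]
      · intro a _ b _ hab
        exact MulAction.injective_ofQuotientStabilizer G x hab
      · intro z hz
        simp only [Finset.mem_filter, Finset.mem_univ, true_and] at hz
        obtain ⟨g, hg⟩ := Quotient.exact (hz.trans hxω.symm)
        exact ⟨g, Finset.mem_univ _, by rw [MulAction.ofQuotientStabilizer_mk]; exact hg⟩
      · intro c _
        rfl
  have hTK := hT.2 hK hKT
  obtain ⟨z, hz⟩ := exists_fixedPoint_of_sylow S T (x := x.1) fun s => by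
    exact congrArg Prod.fst (show (s : G) • x = x from hTK s.2)
  exact hn z hz

/-- Projectivity relative to `S` holds because the index is invertible in `k`. If `K ≤ S` also
serves, then `G / K` must have an `S`-fixed coset `gK`; this puts a conjugate of `S` inside `K`, and
comparing orders gives `K = S`. -/
theorem IsIndecomposable.isVertex_sylow [Finite G] [Fact p.Prime] [CharP k p]
    {ρ : Representation k G V} (S : Sylow p G)
    (hS : ¬ IsProjWithoutFixed (S : Subgroup G) ρ) : IsVertex (S : Subgroup G) ρ := by
  have : Fintype (G ⧸ (S : Subgroup G)) := Fintype.ofFinite _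
  refine ⟨(isRelProjective_iff _ _).2 (isRelProjOn_sylow S ρ), fun K hK hKS => ?_⟩
  by_contra hSK
  have : Fintype (G ⧸ K) := Fintype.ofFinite _
  refine hS (IsProjWithoutFixed.intro (G ⧸ K) (fun c hc => hSK ?_) ((isRelProjective_iff _ _).1 hK))
  obtain ⟨g, rfl⟩ := QuotientGroup.mk_surjective c
  have h1 : (S : Subgroup G).map (MulAut.conj g⁻¹).toMonoidHom ≤ K := by
    rintro _ ⟨s, hs, rfl⟩
    have h2 : ((s * g : G) : G ⧸ K) = (g : G ⧸ K) := hc ⟨s, hs⟩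
    rw [eq_comm, QuotientGroup.eq] at h2
    simpa [mul_assoc] using h2
  have h2 : Nat.card S ≤ Nat.card K := by
    rw [Nat.card_congr ((S : Subgroup G).equivMapOfInjective (MulAut.conj g⁻¹).toMonoidHom
      (MulAut.conj g⁻¹).injective).toEquiv]
    exact Subgroup.card_le_of_le h1
  exact (Subgroup.eq_of_le_of_card_ge hKS h2).ge

/-- A subrepresentation with an invariant complement is a summand. -/
theorem isSummand_of_isCompl {ρ : Representation k G V} (A B : Subrepresentation ρ)
    (h : IsCompl A.toSubmodule B.toSubmodule) : IsSummand A.toRepresentation ρ := by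
  refine IsSummand.of_maps A.toSubmodule.subtype (A.toSubmodule.projectionOnto _ h)
    (fun g v => rfl) (fun g w => ?_) fun v => Submodule.projectionOnto_apply_left h v
  obtain ⟨a, b, rfl, -⟩ := Submodule.existsUnique_add_of_isCompl h w
  have h1 : ρ g a = (A.toRepresentation g a : A.toSubmodule) := rfl
  have h2 : ρ g b = (B.toRepresentation g b : B.toSubmodule) := rfl
  rw [map_add, h1, h2]
  simp only [map_add, Submodule.projectionOnto_apply_left, Submodule.projectionOnto_apply_right,
    map_zero]

theorem isSummand_prod_of_isCompl {ρ : Representation k G V} (A B : Subrepresentation ρ)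
    (h : IsCompl A.toSubmodule B.toSubmodule) :
    IsSummand ρ (A.toRepresentation.prod B.toRepresentation) := by
  refine IsSummand.of_maps (Submodule.prodEquivOfIsCompl _ _ h).symm.toLinearMap
    (Submodule.prodEquivOfIsCompl _ _ h).toLinearMap (fun g v => ?_) (fun g w => ?_)
    fun v => LinearEquiv.apply_symm_apply _ v
  · obtain ⟨w, rfl⟩ := (Submodule.prodEquivOfIsCompl _ _ h).surjective v
    simp only [LinearEquiv.coe_coe, LinearEquiv.symm_apply_apply]
    rw [LinearEquiv.symm_apply_eq]
    simp [Subrepresentation.toRepresentation]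
  · simp [Subrepresentation.toRepresentation]

end Sylow

/-! ### Detecting Sylow-vertex components -/

section

variable {k : Type u} [Field k] {G : Type v} [Group G] {p : ℕ}

/-- Induction on the dimension. If a decomposable module is not projective relative to a set without
`S`-fixed points, neither are both of its two summands, so the property fails for a summand of
smaller dimension. -/
theorem hasSylowVertexComponent_of_not_isProjWithoutFixed [Finite G] [Fact p.Prime] [CharP k p]
    (S : Sylow p G) (n : ℕ) : ∀ {V : Type u} [AddCommGroup V] [Module k V] [Module.Finite k V]
      (ρ : Representation k G V), Module.finrank k V ≤ n →
      ¬ IsProjWithoutFixed (S : Subgroup G) ρ → HasSylowVertexComponent p ρ := by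
  have h0 : ∀ {V : Type u} [AddCommGroup V] [Module k V] (ρ : Representation k G V),
      Subsingleton V → IsProjWithoutFixed (S : Subgroup G) ρ := by
    intro V _ _ ρ hV
    -- The zero module is projective relative to the empty `G`-set.
    let _ : MulAction G Empty :=
      { smul := fun _ x => x, one_smul := fun _ => rfl, mul_smul := fun _ _ _ => rfl }
    exact IsProjWithoutFixed.intro Empty (fun x => x.elim)
      ⟨fun x => x.elim, fun _ x => x.elim, fun v => Subsingleton.elim _ _⟩
  induction n with
  | zero =>
    intro V _ _ _ ρ hn hS
    exact (hS (h0 ρ (Module.finrank_zero_iff.1 (Nat.le_zero.1 hn)))).elim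
  | succ n ih =>
    intro V _ _ _ ρ hn hS
    have hV : Nontrivial V := not_subsingleton_iff_nontrivial.1 fun h => hS (h0 ρ h)
    by_cases hind : IsIndecomposable ρ
    · exact ⟨V, _, _, ρ, hind, IsSummand.refl ρ, S, IsIndecomposable.isVertex_sylow S hS⟩
    · have hind' := fun h => hind ⟨hV, h⟩
      obtain ⟨A, B, hAB, hA, hB⟩ : ∃ A B : Subrepresentation ρ,
          IsCompl A.toSubmodule B.toSubmodule ∧ A.toSubmodule ≠ ⊥ ∧ B.toSubmodule ≠ ⊥ := by
        by_contra hne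
        push Not at hne
        exact hind' fun A B h => or_iff_not_imp_left.2 (hne A B h)
      have key : ∀ A B : Subrepresentation ρ, IsCompl A.toSubmodule B.toSubmodule →
          B.toSubmodule ≠ ⊥ → ¬ IsProjWithoutFixed (S : Subgroup G) A.toRepresentation →
          HasSylowVertexComponent p ρ := by
        intro A B hAB hB hA
        have hlt : Module.finrank k A.toSubmodule < Module.finrank k V := by
          refine Submodule.finrank_lt (fun h => hB ?_)
          have := hAB.disjoint
          rw [h] at this
          exact disjoint_top.1 this.symm
        obtain ⟨U, i1, i2, σ, h1, h2, h3⟩ := ih A.toRepresentation (by omega) hA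
        exact ⟨U, i1, i2, σ, h1, h2.trans (isSummand_of_isCompl A B hAB), h3⟩
      by_cases hSA : IsProjWithoutFixed (S : Subgroup G) A.toRepresentation
      · refine key B A hAB.symm hA fun hSB => hS ?_
        exact (hSA.prod hSB).of_isSummand (isSummand_prod_of_isCompl A B hAB)
      · exact key A B hAB hB hSA

theorem hasSylowVertexComponent_iff [Finite G] [Fact p.Prime] [CharP k p] (S : Sylow p G)
    {V : Type u} [AddCommGroup V] [Module k V] [Module.Finite k V] (ρ : Representation k G V) :
    HasSylowVertexComponent p ρ ↔ ¬ IsProjWithoutFixed (S : Subgroup G) ρ := by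
  refine ⟨?_, hasSylowVertexComponent_of_not_isProjWithoutFixed S _ ρ le_rfl⟩
  rintro ⟨U, _, _, σ, hσ, hs, T, hT⟩ hS
  have := hs.finite
  exact hσ.not_isProjWithoutFixed S T hT (hS.of_isSummand hs)

end

/-! ### Frames and tame `G`-sets -/

section Frames

variable {k : Type*} [Field k] {G : Type*} [Group G] {p : ℕ}
  {V : Type*} [AddCommGroup V] [Module k V] {W : Type*} [AddCommGroup W] [Module k W]

/-- An equivariant frame indexed by `X`: it exhibits `ρ` as a summand of the permutation module
on `X`. -/
def HasFrame (X : Type*) [Fintype X] [MulAction G X] (ρ : Representation k G V) : Prop :=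
  ∃ (e : X → V) (φ : X → V →ₗ[k] k), (∀ (g : G) x, e (g • x) = ρ g (e x)) ∧
    (∀ (g : G) x v, φ (g • x) (ρ g v) = φ x v) ∧ ∀ v, ∑ x, φ x v • e x = v

/-- Every point of `X` fixed by `S` is fixed by `G`. -/
def IsTame (S : Subgroup G) (X : Type*) [MulAction G X] : Prop :=
  ∀ x ∈ MulAction.fixedPoints S X, x ∈ MulAction.fixedPoints G X

theorem IsTame.of_forall_notMem {S : Subgroup G} {X : Type*} [MulAction G X]
    (h : ∀ x, x ∉ MulAction.fixedPoints S X) : IsTame S X := fun x hx => (h x hx).elim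

theorem IsTame.sum {S : Subgroup G} {X Y : Type*} [MulAction G X] [MulAction G Y]
    (hX : IsTame S X) (hY : IsTame S Y) : IsTame S (X ⊕ Y) := by
  rintro (x | x) h g
  · exact congrArg Sum.inl (hX x (fun s => Sum.inl_injective (h s)) g)
  · exact congrArg Sum.inr (hY x (fun s => Sum.inr_injective (h s)) g)

theorem IsTame.prod {S : Subgroup G} {X Y : Type*} [MulAction G X] [MulAction G Y]
    (hX : IsTame S X) (hY : IsTame S Y) : IsTame S (X × Y) := fun x h g =>
  Prod.ext (hX x.1 (fun s => congrArg Prod.fst (h s)) g)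
    (hY x.2 (fun s => congrArg Prod.snd (h s)) g)

theorem IsTame.of_equiv {S : Subgroup G} {X Y : Type*} [MulAction G X] [MulAction G Y]
    (hX : IsTame S X) (e : X ≃ Y) (he : ∀ (g : G) x, e (g • x) = g • e x) : IsTame S Y := by
  intro y hy g
  have h1 := hX (e.symm y) (fun s => e.injective (by
    have := hy s
    rw [Subgroup.smul_def] at this ⊢
    rw [he, e.apply_symm_apply, this])) g
  rw [← e.apply_symm_apply y, ← he, h1]

theorem HasFrame.of_isSummand {X : Type*} [Fintype X] [MulAction G X]
    {ρ : Representation k G V} {σ : Representation k G W} (h : HasFrame X ρ)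
    (hs : IsSummand σ ρ) : HasFrame X σ := by
  obtain ⟨e, φ, he, hφ, h⟩ := h
  obtain ⟨i, r, hi, hr, hir⟩ := hs.exists_maps
  refine ⟨fun x => r (e x), fun x => φ x ∘ₗ i, fun g x => by simp only [he, hr],
    fun g x v => by simp [hi, hφ], fun v => ?_⟩
  simp only [LinearMap.comp_apply, ← map_smul, ← map_sum, h, hir]

theorem HasFrame.of_equiv {X Y : Type*} [Fintype X] [MulAction G X] [Fintype Y] [MulAction G Y]
    {ρ : Representation k G V} (h : HasFrame X ρ) (f : X ≃ Y)
    (hf : ∀ (g : G) x, f (g • x) = g • f x) : HasFrame Y ρ := by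
  obtain ⟨e, φ, he, hφ, h⟩ := h
  have hf' : ∀ (g : G) y, f.symm (g • y) = g • f.symm y := fun g y => by
    rw [f.symm_apply_eq, hf, f.apply_symm_apply]
  refine ⟨fun y => e (f.symm y), fun y => φ (f.symm y), fun g y => by simp only [hf', he],
    fun g y v => by simp only [hf', hφ], fun v => ?_⟩
  conv_rhs => rw [← h v]
  exact Fintype.sum_equiv f.symm _ _ fun _ => rfl

theorem HasFrame.prod {X Y : Type*} [Fintype X] [MulAction G X] [Fintype Y] [MulAction G Y]
    {ρ : Representation k G V} {σ : Representation k G W} (h : HasFrame X ρ)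
    (h' : HasFrame Y σ) : HasFrame (X ⊕ Y) (ρ.prod σ) := by
  obtain ⟨e, φ, he, hφ, h⟩ := h
  obtain ⟨e', φ', he', hφ', h'⟩ := h'
  refine ⟨Sum.elim (fun x => (e x, 0)) (fun y => (0, e' y)),
    Sum.elim (fun x => φ x ∘ₗ LinearMap.fst k V W) (fun y => φ' y ∘ₗ LinearMap.snd k V W),
    ?_, ?_, fun v => ?_⟩
  · rintro g (x | x)
    · simp [he]
    · simp [he']
  · rintro g (x | x) v
    · simp [hφ]
    · simp [hφ']
  · refine Prod.ext ?_ ?_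
    · simp [Fintype.sum_sum_type, Prod.fst_sum, h]
    · simp [Fintype.sum_sum_type, Prod.snd_sum, h']

/-- The vectors `θ_y (e_x)` with the functionals `φ_x` form a frame. Its use: if `Y` has no
`S`-fixed points then neither has `Y × X`, so the new index set is tame. -/
theorem HasFrame.isRelProjOn_prod {X Y : Type*} [Fintype X] [MulAction G X] [Fintype Y]
    [MulAction G Y] {ρ : Representation k G V} (h : HasFrame X ρ) (h' : IsRelProjOn Y ρ) :
    HasFrame (Y × X) ρ := by
  obtain ⟨e, φ, he, hφ, h⟩ := h
  obtain ⟨θ, hθ, h'⟩ := h'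
  refine ⟨fun z => θ z.1 (e z.2), fun z => φ z.2, fun g z => by simp [he, hθ],
    fun g z v => by simp [hφ], fun v => ?_⟩
  rw [Fintype.sum_prod_type]
  simp only [← map_smul, ← map_sum, h, h']

/-- The `G`-fixed points contribute nothing and may be discarded; by tameness no `S`-fixed point
remains. -/
theorem IsProjWithoutFixed.of_tame {S : Subgroup G} {X : Type*} [Fintype X] [MulAction G X]
    (hX : IsTame S X) {ρ : Representation k G V} (θ : X → V →ₗ[k] V)
    (hθ : ∀ (g : G) x v, θ (g • x) (ρ g v) = ρ g (θ x v)) (hs : ∀ v, ∑ x, θ x v = v)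
    (h0 : ∀ x ∈ MulAction.fixedPoints G X, θ x = 0) : IsProjWithoutFixed S ρ := by
  classical
  let _ : MulAction G {x : X // x ∉ MulAction.fixedPoints G X} :=
    { smul := fun g x => ⟨g • x.1, fun h => x.2 fun a => by
        have h1 := h (g * a * g⁻¹)
        rw [smul_smul, inv_mul_cancel_right, mul_smul] at h1
        exact MulAction.injective g h1⟩
      one_smul := fun x => Subtype.ext (one_smul G x.1)
      mul_smul := fun g h x => Subtype.ext (mul_smul g h x.1) }
  refine IsProjWithoutFixed.intro {x : X // x ∉ MulAction.fixedPoints G X}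
    (fun x hx => x.2 (hX x.1 fun s => congrArg Subtype.val (hx s)))
    ⟨fun x => θ x.1, fun g x v => hθ g x.1 v, fun v => ?_⟩
  conv_rhs => rw [← hs v]
  rw [← Finset.sum_filter_of_ne (p := fun x => x ∉ MulAction.fixedPoints G X)
    fun x _ hne hx => hne (by rw [h0 x hx, LinearMap.zero_apply])]
  exact (Finset.sum_subtype _ (fun x => by simp) fun x => θ x v).symm

/-- Summands of permutation modules on tame `G`-sets. -/
def HasTameFrame (S : Subgroup G) (ρ : Representation k G V) : Prop :=
  ∃ (n : ℕ) (_ : MulAction G (Fin n)), IsTame S (Fin n) ∧ HasFrame (Fin n) ρ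

theorem HasTameFrame.intro {S : Subgroup G} (X : Type*) [Fintype X] [MulAction G X]
    (hX : IsTame S X) {ρ : Representation k G V} (h : HasFrame X ρ) : HasTameFrame S ρ := by
  obtain ⟨n, inst, e, he⟩ := exists_fin_action (G := G) X
  exact ⟨n, inst, hX.of_equiv e he, h.of_equiv e he⟩

theorem hasFrame_trivial (n : ℕ) [MulAction G (Fin n)] (h : ∀ (g : G) (i : Fin n), g • i = i) :
    HasFrame (Fin n) (Representation.trivial k G (Fin n → k)) := by
  refine ⟨fun i => Pi.single i 1, fun i => LinearMap.proj i, fun g x => ?_, fun g x v => ?_,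
    fun v => ?_⟩
  · rw [h]; rfl
  · rw [h]; rfl
  · ext j
    simp [Pi.single_apply]

end Frames

/-! ### `p`-permutation modules and their trivial summands -/

section PPermutation

variable {k : Type u} [Field k] {G : Type v} [Group G] {p : ℕ}

/-- An invariant basis with its coordinate functionals is a frame, and frames restrict to summands.
Conversely the `φ_x` map the module into functions on the index set and the `e_x` map back, with
composite the identity. -/
theorem isPPermutation_iff {V : Type u} [AddCommGroup V] [Module k V]
    (ρ : Representation k G V) :
    IsPPermutation ρ ↔ ∃ (n : ℕ) (_ : MulAction G (Fin n)), HasFrame (Fin n) ρ := by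
  constructor
  · rintro ⟨P, _, _, π, ⟨n, b, hb⟩, hs⟩
    choose a ha using hb
    have hinj := b.injective
    let inst : MulAction G (Fin n) :=
      { smul := a
        one_smul := fun i => hinj (by
          change b (a 1 i) = b i
          rw [← ha, map_one]; rfl)
        mul_smul := fun g h i => hinj (by
          change b (a (g * h) i) = b (a g (a h i))
          rw [← ha, ← ha, ← ha, map_mul]; rfl) }
    have ha' : ∀ (g : G) i, b (g • i) = π g (b i) := fun g i => (ha g i).symm
    refine ⟨n, inst, HasFrame.of_isSummand ⟨b, b.coord, ha', fun g i v => ?_, fun v => ?_⟩ hs⟩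
    · suffices b.coord (g • i) ∘ₗ π g = b.coord i from LinearMap.congr_fun this v
      refine b.ext fun j => ?_
      rw [LinearMap.comp_apply, ← ha', b.coord_apply, b.coord_apply, b.repr_self, b.repr_self,
        Finsupp.single_apply, Finsupp.single_apply]
      simp only [smul_left_cancel_iff]
    · simp
  · rintro ⟨n, inst, e, φ, he, hφ, h⟩
    let π : Representation k G (Fin n → k) :=
      { toFun := fun g => LinearMap.funLeft k k (g⁻¹ • ·)
        map_one' := by ext; simp
        map_mul' := fun g h => LinearMap.ext fun f => funext fun i => by
          simp [LinearMap.funLeft_apply, mul_smul] }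
    have hπ : ∀ g f i, π g f i = f (g⁻¹ • i) := fun _ _ _ => rfl
    refine ⟨Fin n → k, _, _, π, ⟨n, Pi.basisFun k _, fun g i => ⟨g • i, ?_⟩⟩,
      IsSummand.of_maps (LinearMap.pi φ) (∑ i, (LinearMap.proj i).smulRight (e i))
        (fun g v => ?_) (fun g w => ?_) fun v => ?_⟩
    · ext j
      rw [hπ]
      simp only [Pi.basisFun_apply, Pi.single_apply, inv_smul_eq_iff]
    · ext i
      have := hφ g (g⁻¹ • i) v
      rw [smul_inv_smul] at this
      rw [hπ, LinearMap.pi_apply, LinearMap.pi_apply, this]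
    · simp only [LinearMap.sum_apply, LinearMap.smulRight_apply, LinearMap.proj_apply, map_sum,
        map_smul, hπ, ← he]
      exact Fintype.sum_equiv (MulAction.toPerm g⁻¹) _ _ fun i => by simp
    · simp [LinearMap.sum_apply, h]

theorem IsPPermutation.finite {V : Type u} [AddCommGroup V] [Module k V]
    {ρ : Representation k G V} (h : IsPPermutation ρ) : Module.Finite k V := by
  obtain ⟨P, _, _, π, ⟨n, b, hb⟩, hs⟩ := h
  have := Module.Finite.of_basis b
  exact hs.finite

/-- Trivial summands are split off one at a time. When none is left, the fixed part of the frame is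
square-zero, and correcting by a unipotent map shows that the non-fixed part alone gives relative
projectivity. -/
theorem HasTameFrame.exists_equiv [Finite G] {S : Subgroup G} (d : ℕ) :
    ∀ {V : Type u} [AddCommGroup V] [Module k V] [Module.Finite k V] (ρ : Representation k G V),
      Module.finrank k V ≤ d → HasTameFrame S ρ →
    ∃ (n : ℕ) (W : Type u) (_ : AddCommGroup W) (_ : Module k W) (τ : Representation k G W),
      IsPPermutation τ ∧ IsProjWithoutFixed S τ ∧
      Nonempty (ρ.Equiv ((Representation.trivial k G (Fin n → k)).prod τ)) := by
  induction d with
  | zero =>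
    intro V _ _ _ ρ hd ⟨n, inst, hn, h⟩
    have hV : Subsingleton V := Module.finrank_zero_iff.1 (Nat.le_zero.1 hd)
    have : Subsingleton (Fin 0 → k) := inferInstance
    refine ⟨0, V, _, _, ρ, (isPPermutation_iff ρ).2 ⟨n, inst, h⟩,
      IsProjWithoutFixed.of_tame hn (fun _ => 0) (fun _ _ _ => Subsingleton.elim _ _)
        (fun _ => Subsingleton.elim _ _) fun _ _ => rfl,
      ⟨Representation.Equiv.mk (LinearEquiv.ofBijective 0 ⟨fun _ _ _ => Subsingleton.elim _ _,
        fun b => ⟨0, Subsingleton.elim _ _⟩⟩) fun g => LinearMap.ext fun v =>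
          Subsingleton.elim _ _⟩⟩
  | succ d ih =>
    intro V _ _ _ ρ hd ⟨n, inst, hn, hfr⟩
    by_cases hk : ∃ (e₀ : V) (φ₀ : V →ₗ[k] k), (∀ g, ρ g e₀ = e₀) ∧ (∀ g v, φ₀ (ρ g v) = φ₀ v) ∧
        φ₀ e₀ = 1
    · obtain ⟨e₀, φ₀, he₀, hφ₀, h1⟩ := hk
      let K : Subrepresentation ρ := ⟨LinearMap.ker φ₀, fun g v hv => by
        rw [LinearMap.mem_ker] at hv ⊢; rw [hφ₀, hv]⟩
      let q : V →ₗ[k] K.toSubmodule :=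
        (LinearMap.id - φ₀.smulRight e₀).codRestrict (LinearMap.ker φ₀) fun v => by simp [h1]
      have hq : ∀ v, (q v : V) = v - φ₀ v • e₀ := fun v => rfl
      have hqρ : ∀ g v, q (ρ g v) = K.toRepresentation g (q v) := fun g v => Subtype.ext (by
        change ρ g v - φ₀ (ρ g v) • e₀ = ρ g (v - φ₀ v • e₀)
        rw [hφ₀, map_sub, map_smul, he₀])
      have hqK : ∀ w : K.toSubmodule, q w = w := fun w => Subtype.ext (by
        have : φ₀ w = 0 := w.2
        rw [hq, this, zero_smul, sub_zero])
      have hqe : q e₀ = 0 := Subtype.ext (by rw [hq, h1, one_smul, sub_self]; rfl)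
      have hK : IsSummand K.toRepresentation ρ :=
        IsSummand.of_maps K.toSubmodule.subtype q (fun _ _ => rfl) hqρ hqK
      have hlt : Module.finrank k K.toSubmodule < Module.finrank k V := by
        refine Submodule.finrank_lt fun h => ?_
        have : e₀ ∈ K.toSubmodule := by rw [h]; trivial
        have h2 : φ₀ e₀ = 0 := this
        rw [h1] at h2
        exact one_ne_zero h2
      obtain ⟨m, W, i1, i2, τ, hτ, hτ', ⟨E⟩⟩ := ih K.toRepresentation (by omega)
        ⟨n, inst, hn, hfr.of_isSummand hK⟩
      refine ⟨m + 1, W, i1, i2, τ, hτ, hτ', ⟨Representation.Equiv.mk (LinearEquiv.ofLinearMap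
        (LinearMap.prod (LinearMap.pi (Fin.cons φ₀ fun i => LinearMap.proj i ∘ₗ
          LinearMap.fst k _ _ ∘ₗ E.toLinearMap ∘ₗ q))
          (LinearMap.snd k _ _ ∘ₗ E.toLinearMap ∘ₗ q))
        (((LinearMap.proj 0).smulRight e₀ ∘ₗ LinearMap.fst k _ _) +
          K.toSubmodule.subtype ∘ₗ E.symm.toLinearMap ∘ₗ
            LinearMap.prodMap (LinearMap.funLeft k k Fin.succ) LinearMap.id) ?_ ?_) ?_⟩⟩
      · refine LinearMap.ext fun w => ?_
        have hz : φ₀ (w.1 0 • e₀ + (E.symm (w.1 ∘ Fin.succ, w.2) : K.toSubmodule)) = w.1 0 := by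
          have : φ₀ (E.symm (w.1 ∘ Fin.succ, w.2) : K.toSubmodule) = 0 :=
            (E.symm (w.1 ∘ Fin.succ, w.2) : K.toSubmodule).2
          rw [map_add, map_smul, h1, this, smul_eq_mul, mul_one, add_zero]
        have hy : E (q (w.1 0 • e₀ + (E.symm (w.1 ∘ Fin.succ, w.2) : K.toSubmodule))) =
            (w.1 ∘ Fin.succ, w.2) := by
          rw [map_add, map_smul, hqe, smul_zero, zero_add, hqK]
          exact E.toLinearEquiv.apply_symm_apply _
        refine Prod.ext (funext fun i => ?_) ?_
        · refine Fin.cases hz (fun j => ?_) i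
          exact (congrFun (congrArg Prod.fst hy) j :)
        · exact (congrArg Prod.snd hy :)
      · refine LinearMap.ext fun v => ?_
        change φ₀ v • e₀ + (E.symm ((E (q v)).1, (E (q v)).2) : K.toSubmodule) = v
        have : E.symm ((E (q v)).1, (E (q v)).2) = q v := E.toLinearEquiv.symm_apply_apply _
        rw [this, hq]
        abel
      · intro g
        refine LinearMap.ext fun v => ?_
        have hE :
            E (q (ρ g v)) = (((Representation.trivial k G (Fin m → k)).prod τ) g) (E (q v)) := by
          rw [hqρ]; 
          exact IntertwiningMap.isIntertwining _ _ E.toIntertwiningMap g (q v)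
        refine Prod.ext (funext fun i => ?_) ?_
        · refine Fin.cases (hφ₀ g v) (fun j => ?_) i
          exact (congrFun (congrArg Prod.fst hE) j :)
        · exact (congrArg Prod.snd hE :)
    · obtain ⟨e, φ, he, hφ, h⟩ := id hfr
      classical
      -- A nonzero pairing between a fixed functional and a fixed vector would, after rescaling,
      -- split off a further trivial summand.
      have hij : ∀ x ∈ MulAction.fixedPoints G (Fin n), ∀ y ∈ MulAction.fixedPoints G (Fin n),
          φ x (e y) = 0 := by
        intro x hx y hy
        by_contra hne
        refine hk ⟨e y, (φ x (e y))⁻¹ • φ x, fun g => ?_, fun g v => ?_, ?_⟩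
        · rw [← he, hy g]
        · have := hφ g x v
          rw [hx g] at this
          rw [LinearMap.smul_apply, LinearMap.smul_apply, this]
        · rw [LinearMap.smul_apply, smul_eq_mul, inv_mul_cancel₀ hne]
      have hfix : ∀ (g : G) (x : Fin n), g • x ∈ MulAction.fixedPoints G (Fin n) ↔
          x ∈ MulAction.fixedPoints G (Fin n) := by
        intro g x
        constructor
        · intro hx a
          have h1 := hx (g * a * g⁻¹)
          rw [smul_smul, inv_mul_cancel_right, mul_smul] at h1
          exact MulAction.injective g h1
        · intro hx a
          rw [hx g, hx a]
      -- The fixed part `c` of the frame satisfies `c ^ 2 = 0`, so `(1 + c)(1 - c) = 1`. The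
      -- non-fixed part sums to `1 - c`; composing it with `1 + c` gives the identity.
      let c : V →ₗ[k] V := ∑ x with x ∈ MulAction.fixedPoints G (Fin n), (φ x).smulRight (e x)
      have hc : ∀ v, c v = ∑ x with x ∈ MulAction.fixedPoints G (Fin n), φ x v • e x := fun v => by
        simp [c, LinearMap.sum_apply]
      have hcc : ∀ v, c (c v) = 0 := by
        intro v
        rw [hc v, map_sum]
        refine Finset.sum_eq_zero fun y hy => ?_
        rw [map_smul, hc]
        rw [Finset.sum_eq_zero, smul_zero]
        intro x hx
        rw [hij x (by simpa using hx) y (by simpa using hy), zero_smul]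
      have hcρ : ∀ g v, c (ρ g v) = ρ g (c v) := by
        intro g v
        rw [hc, hc, map_sum]
        refine Finset.sum_congr rfl fun x hx => ?_
        have hx' : x ∈ MulAction.fixedPoints G (Fin n) := by simpa using hx
        have h1 := hφ g x v
        have h2 := he g x
        rw [hx' g] at h1 h2
        rw [h1, map_smul, ← h2]
      have hnc : ∀ v, ∑ x with x ∉ MulAction.fixedPoints G (Fin n), φ x v • e x = v - c v := by
        intro v
        rw [eq_sub_iff_add_eq', hc, Finset.sum_filter_add_sum_filter_not, h]
      refine ⟨0, V, _, _, ρ, (isPPermutation_iff ρ).2 ⟨n, inst, hfr⟩,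
        IsProjWithoutFixed.of_tame hn (fun x => if x ∈ MulAction.fixedPoints G (Fin n) then 0 else
          (LinearMap.id + c) ∘ₗ (φ x).smulRight (e x)) (fun g x v => ?_) (fun v => ?_)
          fun x hx => if_pos hx, ⟨Representation.Equiv.mk (LinearEquiv.ofLinearMap
            (LinearMap.prod 0 LinearMap.id) (LinearMap.snd k _ _) ?_ ?_) ?_⟩⟩
      · simp only [hfix]
        split_ifs
        · simp
        · simp [hφ, he, hcρ]
      · have : ∀ x, (if x ∈ MulAction.fixedPoints G (Fin n) then 0 else
            (LinearMap.id + c) ∘ₗ (φ x).smulRight (e x)) v =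
            if x ∉ MulAction.fixedPoints G (Fin n) then
              (LinearMap.id + c : V →ₗ[k] V) (φ x v • e x) else 0 := by
          intro x
          by_cases hx : x ∈ MulAction.fixedPoints G (Fin n)
          · rw [if_pos hx, if_neg (not_not.2 hx)]; rfl
          · rw [if_neg hx, if_pos hx]; rfl
        rw [Finset.sum_congr rfl fun x _ => this x, ← Finset.sum_filter, ← map_sum, hnc]
        simp [hcc]
      · refine LinearMap.ext fun w => Prod.ext (Subsingleton.elim _ _) rfl
      · rfl
      · intro g
        exact LinearMap.ext fun v => Prod.ext (Subsingleton.elim _ _) rfl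

end PPermutation

/-! ### Frames of `Hom(V, W)` and tame pairs -/

section HomFrames

variable {k : Type*} [Field k] {G : Type*} [Group G]
  {V : Type*} [AddCommGroup V] [Module k V] {W : Type*} [AddCommGroup W] [Module k W]
  {V' : Type*} [AddCommGroup V'] [Module k V'] {W' : Type*} [AddCommGroup W'] [Module k W']

/-- An equivariant frame of `Hom(V, W)` indexed by `X`, with the dual frame written as a family of
maps `W → V` through the trace form. -/
def HasHomFrame (X : Type*) [Fintype X] [MulAction G X] (ρ : Representation k G V)
    (σ : Representation k G W) : Prop :=
  ∃ (e : X → V →ₗ[k] W) (a : X → W →ₗ[k] V), (∀ g x v, e (g • x) (ρ g v) = σ g (e x v)) ∧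
    (∀ g x w, a (g • x) (σ g w) = ρ g (a x w)) ∧ ∀ v w, ∑ x, a x w ⊗ₜ[k] e x v = v ⊗ₜ[k] w

theorem HasHomFrame.of_equiv {X Y : Type*} [Fintype X] [MulAction G X] [Fintype Y] [MulAction G Y]
    {ρ : Representation k G V} {σ : Representation k G W} (h : HasHomFrame X ρ σ) (f : X ≃ Y)
    (hf : ∀ (g : G) x, f (g • x) = g • f x) : HasHomFrame Y ρ σ := by
  obtain ⟨e, a, he, ha, h⟩ := h
  have hf' : ∀ (g : G) y, f.symm (g • y) = g • f.symm y := fun g y => by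
    rw [f.symm_apply_eq, hf, f.apply_symm_apply]
  refine ⟨fun y => e (f.symm y), fun y => a (f.symm y), fun g y v => by simp only [hf', he],
    fun g y v => by simp only [hf', ha], fun v w => ?_⟩
  rw [← h v w]
  exact Fintype.sum_equiv f.symm _ _ fun _ => rfl

/-- `Hom(V, W)` is a summand of a permutation module on a tame `G`-set. -/
def IsTamePair (S : Subgroup G) (ρ : Representation k G V) (σ : Representation k G W) : Prop :=
  ∃ (n : ℕ) (_ : MulAction G (Fin n)), IsTame S (Fin n) ∧ HasHomFrame (Fin n) ρ σ

theorem IsTamePair.intro {S : Subgroup G} (X : Type*) [Fintype X] [MulAction G X]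
    (hX : IsTame S X) {ρ : Representation k G V} {σ : Representation k G W}
    (h : HasHomFrame X ρ σ) : IsTamePair S ρ σ := by
  obtain ⟨n, inst, e, he⟩ := exists_fin_action (G := G) X
  exact ⟨n, inst, hX.of_equiv e he, h.of_equiv e he⟩

theorem IsTamePair.symm {S : Subgroup G} {ρ : Representation k G V} {σ : Representation k G W}
    (h : IsTamePair S ρ σ) : IsTamePair S σ ρ := by
  obtain ⟨n, inst, hn, e, a, he, ha, h⟩ := h
  refine ⟨n, inst, hn, a, e, ha, he, fun w v => ?_⟩
  have := congrArg (TensorProduct.comm k V W) (h v w)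
  simpa only [map_sum, TensorProduct.comm_tmul] using this

theorem IsTamePair.of_isSummand {S : Subgroup G} {ρ : Representation k G V}
    {σ : Representation k G W} {ρ' : Representation k G V'} {σ' : Representation k G W'}
    (h : IsTamePair S ρ σ) (hρ : IsSummand ρ' ρ) (hσ : IsSummand σ' σ) : IsTamePair S ρ' σ' := by
  obtain ⟨n, inst, hn, e, a, he, ha, h⟩ := h
  obtain ⟨i, r, hi, hr, hir⟩ := hρ.exists_maps
  obtain ⟨j, s, hj, hs, hjs⟩ := hσ.exists_maps
  refine ⟨n, inst, hn, fun x => s ∘ₗ e x ∘ₗ i, fun x => r ∘ₗ a x ∘ₗ j, fun g x v => ?_,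
    fun g x w => ?_, fun v w => ?_⟩
  · simp [hi, he, hs]
  · simp [hj, ha, hr]
  · have := congrArg (TensorProduct.map r s) (h (i v) (j w))
    simpa only [map_sum, TensorProduct.map_tmul, hir, hjs, LinearMap.comp_apply] using this

theorem IsTamePair.prod_left {S : Subgroup G} {ρ : Representation k G V}
    {ρ' : Representation k G V'} {σ : Representation k G W}
    (h : IsTamePair S ρ σ) (h' : IsTamePair S ρ' σ) : IsTamePair S (ρ.prod ρ') σ := by
  obtain ⟨n, inst, hn, e, a, he, ha, h⟩ := h
  obtain ⟨m, inst', hm, e', a', he', ha', h'⟩ := h'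
  refine IsTamePair.intro (Fin n ⊕ Fin m) (hn.sum hm)
    ⟨Sum.elim (fun x => e x ∘ₗ LinearMap.fst k V V') fun x => e' x ∘ₗ LinearMap.snd k V V',
    Sum.elim (fun x => LinearMap.inl k V V' ∘ₗ a x) fun x => LinearMap.inr k V V' ∘ₗ a' x,
    ?_, ?_, fun v w => ?_⟩
  · rintro g (x | x) v
    · simp [he]
    · simp [he']
  · rintro g (x | x) v
    · simp [ha]
    · simp [ha']
  · have h1 := congrArg ((LinearMap.inl k V V').rTensor W) (h v.1 w)
    have h2 := congrArg ((LinearMap.inr k V V').rTensor W) (h' v.2 w)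
    simp only [map_sum, LinearMap.rTensor_tmul] at h1 h2
    simp only [Fintype.sum_sum_type, Sum.elim_inl, Sum.elim_inr, LinearMap.comp_apply,
      LinearMap.fst_apply, LinearMap.snd_apply]
    rw [h1, h2, ← TensorProduct.add_tmul]
    simp

/-- These are the four blocks of the endomorphisms of a direct sum; the two off-diagonal ones are
exchanged by symmetry. -/
theorem IsTamePair.prod_self_iff {S : Subgroup G} {ρ : Representation k G V}
    {σ : Representation k G W} : IsTamePair S (ρ.prod σ) (ρ.prod σ) ↔
      IsTamePair S ρ ρ ∧ IsTamePair S ρ σ ∧ IsTamePair S σ σ := by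
  have h1 : IsSummand ρ (ρ.prod σ) := ⟨_, _, IntertwiningMap.fst_comp_inl⟩
  have h2 : IsSummand σ (ρ.prod σ) := ⟨_, _, IntertwiningMap.snd_comp_inr⟩
  refine ⟨fun h => ⟨h.of_isSummand h1 h1, h.of_isSummand h1 h2, h.of_isSummand h2 h2⟩, ?_⟩
  rintro ⟨h11, h12, h22⟩
  exact (h11.prod_left h12.symm).symm.prod_left (h12.prod_left h22).symm

theorem IsTamePair.tprod {S : Subgroup G} {ρ : Representation k G V}
    {σ : Representation k G W} {ρ' : Representation k G V'} {σ' : Representation k G W'}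
    (h : IsTamePair S ρ σ) (h' : IsTamePair S ρ' σ') :
    IsTamePair S (ρ.tprod ρ') (σ.tprod σ') := by
  obtain ⟨n, inst, hn, e, a, he, ha, h⟩ := h
  obtain ⟨m, inst', hm, e', a', he', ha', h'⟩ := h'
  refine IsTamePair.intro (Fin n × Fin m) (hn.prod hm)
    ⟨fun x => TensorProduct.map (e x.1) (e' x.2), fun x => TensorProduct.map (a x.1) (a' x.2),
    fun g x v => ?_, fun g x w => ?_, fun v w => ?_⟩
  · induction v with
    | zero => simp
    | add v v' hv hv' => rw [map_add, map_add, map_add, map_add, hv, hv']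
    | tmul v v' => simp [he, he']
  · induction w with
    | zero => simp
    | add v v' hv hv' => rw [map_add, map_add, map_add, map_add, hv, hv']
    | tmul v v' => simp [ha, ha']
  · induction v with
    | zero => simp
    | add v₁ v₂ h1 h2 =>
      simp only [map_add, TensorProduct.tmul_add, TensorProduct.add_tmul, Finset.sum_add_distrib,
        h1, h2]
    | tmul v v' =>
      induction w with
      | zero => simp
      | add v₁ v₂ h1 h2 =>
        simp only [map_add, TensorProduct.tmul_add, TensorProduct.add_tmul,
          Finset.sum_add_distrib, h1, h2]
      | tmul w w' =>
        have := congrArg (TensorProduct.tensorTensorTensorComm k V W V' W')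
          (congrArg₂ (fun s t => s ⊗ₜ[k] t) (h v w) (h' v' w'))
        simp only [TensorProduct.sum_tmul, TensorProduct.tmul_sum, map_sum,
          TensorProduct.tensorTensorTensorComm_tmul] at this
        rw [Fintype.sum_prod_type, ← this, Finset.sum_comm]
        rfl

theorem HasHomFrame.sum_apply {X : Type*} [Fintype X] {e : X → V →ₗ[k] W} {a : X → W →ₗ[k] V}
    (h : ∀ v w, ∑ x, a x w ⊗ₜ[k] e x v = v ⊗ₜ[k] w) (μ : V →ₗ[k] k) (v : V) (w : W) :
    ∑ x, μ (a x w) • e x v = μ v • w := by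
  have := congrArg ((TensorProduct.lid k W).toLinearMap ∘ₗ μ.rTensor W) (h v w)
  simpa only [map_sum, LinearMap.comp_apply, LinearMap.rTensor_tmul, LinearEquiv.coe_coe,
    TensorProduct.lid_tmul] using this

theorem linearMap_induction [Module.Finite k V] {P : (V →ₗ[k] W) → Prop} (h0 : P 0)
    (hadd : ∀ f g, P f → P g → P (f + g)) (hr : ∀ (μ : V →ₗ[k] k) w, P (μ.smulRight w))
    (f : V →ₗ[k] W) : P f := by
  obtain ⟨t, rfl⟩ := (dualTensorHomEquiv k V W).surjective f
  induction t with
  | zero => rwa [map_zero]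
  | add x y hx hy => rw [map_add]; exact hadd _ _ hx hy
  | tmul μ w => exact hr μ w

/-- Both sides are linear in `c`, and for `c` of rank one the claim is the frame identity contracted
with a functional. -/
theorem HasHomFrame.sum_comp [Module.Finite k W] {X : Type*} [Fintype X]
    {e : X → V →ₗ[k] W} {a : X → W →ₗ[k] V}
    (h : ∀ v w, ∑ x, a x w ⊗ₜ[k] e x v = v ⊗ₜ[k] w) [Module.Finite k V] (c : V →ₗ[k] V) (w : W) :
    ∑ x, e x (c (a x w)) = LinearMap.trace k V c • w := by
  induction c using linearMap_induction with
  | h0 => simp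
  | hadd f g hf hg => simp [Finset.sum_add_distrib, add_smul, hf, hg]
  | hr μ v =>
    rw [LinearMap.trace_smulRight, ← HasHomFrame.sum_apply h μ v w]
    simp

/-- This is the reconstruction formula of a frame: `a x` represents the coordinate functional `m ↦
tr (a x ∘ m)`. -/
theorem HasHomFrame.sum_trace [Module.Finite k V] {X : Type*} [Fintype X]
    {e : X → V →ₗ[k] W} {a : X → W →ₗ[k] V}
    (h : ∀ v w, ∑ x, a x w ⊗ₜ[k] e x v = v ⊗ₜ[k] w) (m : V →ₗ[k] W) (v : V) :
    ∑ x, LinearMap.trace k V (a x ∘ₗ m) • e x v = m v := by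
  induction m using linearMap_induction with
  | h0 => simp
  | hadd f g hf hg => simp [LinearMap.comp_add, Finset.sum_add_distrib, add_smul, hf, hg]
  | hr μ w =>
    rw [LinearMap.smulRight_apply, ← HasHomFrame.sum_apply h μ v w]
    refine Finset.sum_congr rfl fun x _ => ?_
    have : a x ∘ₗ μ.smulRight w = μ.smulRight (a x w) := by ext; simp
    rw [this, LinearMap.trace_smulRight]

/-- Composition `Hom(V, W) ⊗ Hom(W, V') → Hom(V, V')` is split by inserting `c / tr c` in the
middle. In terms of frames: compose the `e`'s, compose the dual maps through `c`, and apply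
`HasHomFrame.sum_comp`. -/
theorem IsTamePair.trans {S : Subgroup G} {ρ : Representation k G V} {σ : Representation k G W}
    {τ : Representation k G V'} [Module.Finite k W] [Module.Finite k V']
    (h : IsTamePair S ρ σ) (h' : IsTamePair S σ τ)
    (c : W →ₗ[k] W) (hc : ∀ g w, c (σ g w) = σ g (c w)) (htr : LinearMap.trace k W c ≠ 0) :
    IsTamePair S ρ τ := by
  obtain ⟨n, inst, hn, e, a, he, ha, h⟩ := h
  obtain ⟨m, inst', hm, f, b, hf, hb, h'⟩ := h'
  refine IsTamePair.intro (Fin n × Fin m) (hn.prod hm)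
    ⟨fun x => f x.2 ∘ₗ e x.1, fun x => (LinearMap.trace k W c)⁻¹ • (a x.1 ∘ₗ c ∘ₗ b x.2),
    fun g x v => by simp [he, hf], fun g x w => by simp [hb, hc, ha], fun v t => ?_⟩
  rw [Fintype.sum_prod_type, Finset.sum_comm]
  have : ∀ y, ∑ x, ((LinearMap.trace k W c)⁻¹ • (a x ∘ₗ c ∘ₗ b y)) t ⊗ₜ[k] (f y ∘ₗ e x) v =
      (LinearMap.trace k W c)⁻¹ • v ⊗ₜ[k] f y (c (b y t)) := by
    intro y
    have := congrArg ((f y).lTensor V) (h v (c (b y t)))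
    simp only [map_sum, LinearMap.lTensor_tmul] at this
    rw [← this, Finset.smul_sum]
    rfl
  rw [Finset.sum_congr rfl fun y _ => this y, ← Finset.smul_sum, ← TensorProduct.tmul_sum,
    HasHomFrame.sum_comp h', TensorProduct.tmul_smul, smul_smul, inv_mul_cancel₀ htr, one_smul]

theorem tensor_ext_of_dual [Module.Finite k V] {z z' : V ⊗[k] W}
    (h : ∀ μ : V →ₗ[k] k, TensorProduct.lid k W (μ.rTensor W z) =
      TensorProduct.lid k W (μ.rTensor W z')) : z = z' := by
  let b := Module.finBasis k V
  have key : ∀ z : V ⊗[k] W,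
      z = ∑ i, b i ⊗ₜ TensorProduct.lid k W ((b.coord i).rTensor W z) := by
    intro z
    induction z with
    | zero => simp
    | add x y hx hy =>
      simp only [map_add, TensorProduct.tmul_add, Finset.sum_add_distrib]
      rw [← hx, ← hy]
    | tmul v w =>
      simp only [LinearMap.rTensor_tmul, TensorProduct.lid_tmul, ← TensorProduct.smul_tmul,
        ← TensorProduct.sum_tmul]
      simp [b.sum_repr]
  rw [key z, key z']
  simp only [h]

theorem hasTameFrame_linHom_iff {S : Subgroup G} [Module.Finite k V] [Module.Finite k W]
    (ρ : Representation k G V) (σ : Representation k G W) :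
    HasTameFrame S (ρ.linHom σ) ↔ IsTamePair S ρ σ := by
  constructor
  · rintro ⟨n, inst, hn, e, φ, he, hφ, h⟩
    -- The map representing `φ x` under the trace form, obtained by double duality from `μ (a x w) =
    -- φ x (μ ⊗ w)`.
    let a : Fin n → W →ₗ[k] V := fun x => (Module.evalEquiv k V).symm.toLinearMap ∘ₗ
      { toFun := fun w => φ x ∘ₗ (LinearMap.smulRightₗ (R := k) (M := W) (M₂ := V)).flip w
        map_add' := fun w w' => by ext; simp
        map_smul' := fun c w => by ext; simp }
    have ha : ∀ x (μ : V →ₗ[k] k) w, μ (a x w) = φ x (μ.smulRight w) := by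
      intro x μ w
      simp [a, Module.apply_evalEquiv_symm_apply]
    refine ⟨n, inst, hn, e, a, fun g x v => ?_, fun g x w => ?_, fun v w => ?_⟩
    · rw [he]; simp
    · refine (Module.evalEquiv k V).injective (LinearMap.ext fun μ => ?_)
      change μ (a (g • x) (σ g w)) = μ (ρ g (a x w))
      rw [ha]
      have h1 := hφ g x ((μ ∘ₗ ρ g).smulRight w)
      have h2 : ρ.linHom σ g ((μ ∘ₗ ρ g).smulRight w) = μ.smulRight (σ g w) := by
        ext v; simp
      rw [h2] at h1
      rw [h1, ← ha]
      rfl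
    · refine tensor_ext_of_dual fun μ => ?_
      simp only [map_sum, LinearMap.rTensor_tmul, TensorProduct.lid_tmul, ha]
      have := LinearMap.congr_fun (h (μ.smulRight w)) v
      simpa [LinearMap.sum_apply] using this
  · rintro ⟨n, inst, hn, e, a, he, ha, h⟩
    refine ⟨n, inst, hn, e, fun x => LinearMap.trace k V ∘ₗ LinearMap.llcomp k V W V (a x),
      fun g x => ?_, fun g x m => ?_, fun m => ?_⟩
    · ext v
      have := he g x (ρ g⁻¹ v)
      rw [self_inv_apply] at this
      simpa using this
    · have h1 : a (g • x) ∘ₗ (ρ.linHom σ g m) = ρ g ∘ₗ (a x ∘ₗ m) ∘ₗ ρ g⁻¹ := by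
        ext v
        simp [ha]
      change LinearMap.trace k V (a (g • x) ∘ₗ (ρ.linHom σ g m)) = LinearMap.trace k V (a x ∘ₗ m)
      rw [h1, LinearMap.trace_comp_comm', LinearMap.comp_assoc, ← Module.End.mul_eq_comp (ρ g⁻¹),
        ← map_mul, inv_mul_cancel, map_one]
      rfl
    · ext v
      have := HasHomFrame.sum_trace h m v
      rw [LinearMap.sum_apply]
      exact this

end HomFrames

/-! ### Dade modules and capped Dade modules in terms of tame pairs -/

section Characterization

variable {k : Type u} [Field k] {G : Type v} [Group G] {p : ℕ}

/-- In `k ^ n ⊕ W` the first summand has a frame on `n` fixed points. The second is projective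
relative to a set without `S`-fixed points, so its frame can be taken on a product with that set.
The converse is the splitting `HasTameFrame.exists_equiv`. -/
theorem isDade_iff [Finite G] [Fact p.Prime] [CharP k p] (S : Sylow p G)
    {V : Type u} [AddCommGroup V] [Module k V] (ρ : Representation k G V) :
    IsDade p ρ ↔ Module.Finite k V ∧ IsTamePair (S : Subgroup G) ρ ρ := by
  refine and_congr_right fun hV => ?_
  rw [← hasTameFrame_linHom_iff]
  constructor
  · rintro ⟨n, W, _, _, τ, hτ, hτ', ⟨E⟩⟩
    have := hτ.finite
    rw [hasSylowVertexComponent_iff S, not_not] at hτ'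
    obtain ⟨m, inst, hfr⟩ := (isPPermutation_iff τ).1 hτ
    obtain ⟨l, inst', hl, hpr⟩ := hτ'
    let _ : MulAction G (Fin n) :=
      { smul := fun _ x => x, one_smul := fun _ => rfl, mul_smul := fun _ _ _ => rfl }
    refine HasTameFrame.intro (Fin n ⊕ (Fin l × Fin m)) (IsTame.sum (fun _ _ _ => rfl)
      (IsTame.of_forall_notMem fun x hx => hl x.1 fun s => congrArg Prod.fst (hx s)))
      (HasFrame.of_isSummand ?_ (IsSummand.of_equiv E))
    exact (hasFrame_trivial n fun _ _ => rfl).prod (hfr.isRelProjOn_prod hpr)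
  · intro h
    obtain ⟨n, W, i1, i2, τ, hτ, hτ', hE⟩ := h.exists_equiv _ _ le_rfl
    have := hτ.finite
    exact ⟨n, W, i1, i2, τ, hτ, fun h => (hasSylowVertexComponent_iff S τ).1 h hτ', hE⟩

theorem dvd_card_of_forall_notMem [Fact p.Prime] (S : Sylow p G) (X : Type*)
    [Finite X] [MulAction G X] (hX : ∀ x : X, x ∉ MulAction.fixedPoints (S : Subgroup G) X) :
    p ∣ Nat.card X := by
  have := S.2.card_modEq_card_fixedPoints X
  rw [Nat.card_eq_zero (α := MulAction.fixedPoints (S : Subgroup G) X) |>.2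
    (Or.inl ⟨fun x => hX x.1 x.2⟩)] at this
  exact Nat.modEq_zero_iff_dvd.1 this

/-- In characteristic `p`, an invariant function on a `G`-set without `S`-fixed points has
sum zero. -/
theorem sum_eq_zero_of_forall_notMem [Fact p.Prime] [CharP k p] (S : Sylow p G)
    {X : Type*} [Fintype X] [MulAction G X]
    (hX : ∀ x : X, x ∉ MulAction.fixedPoints (S : Subgroup G) X) (f : X → k)
    (hf : ∀ (g : G) x, f (g • x) = f x) : ∑ x, f x = 0 := by
  classical
  -- Each level set of `f` is `G`-stable without `S`-fixed points, so its cardinality vanishes in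
  -- `k`.
  rw [← Finset.sum_fiberwise_of_maps_to (t := Finset.univ.image f) (g := f)
    fun x _ => Finset.mem_image_of_mem f (Finset.mem_univ x)]
  refine Finset.sum_eq_zero fun t _ => ?_
  rw [Finset.sum_congr rfl fun x hx => (Finset.mem_filter.1 hx).2, Finset.sum_const,
    nsmul_eq_mul]
  let _ : MulAction G {x : X // f x = t} :=
    { smul := fun g x => ⟨g • x.1, (hf g x.1).trans x.2⟩
      one_smul := fun x => Subtype.ext (one_smul G x.1)
      mul_smul := fun g h x => Subtype.ext (mul_smul g h x.1) }
  have := dvd_card_of_forall_notMem S {x : X // f x = t}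
    fun x hx => hX x.1 fun s => congrArg Subtype.val (hx s)
  rw [Nat.card_eq_fintype_card, Fintype.card_subtype] at this
  rw [(CharP.cast_eq_zero_iff k p _).2 this, zero_mul]

/-- If all equivariant endomorphisms have trace zero, then in `id = ∑ tr(a_x) e_x` the terms at
fixed points vanish, since `a_x` is equivariant there. Conversely, if `id = ∑ θ_x` over a set
without `S`-fixed points, then `tr c = ∑ tr(θ_x c)` is a sum of an invariant function, hence zero.
-/
theorem hasSylowVertexComponent_iff_exists_trace [Finite G] [Fact p.Prime] [CharP k p]
    (S : Sylow p G) {V : Type u} [AddCommGroup V] [Module k V] [Module.Finite k V]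
    {ρ : Representation k G V} (h : IsTamePair (S : Subgroup G) ρ ρ) :
    HasSylowVertexComponent p ρ ↔ ∃ c : V →ₗ[k] V, (∀ g v, c (ρ g v) = ρ g (c v)) ∧
      LinearMap.trace k V c ≠ 0 := by
  rw [hasSylowVertexComponent_iff S, not_iff_comm]
  constructor
  · intro htr
    push Not at htr
    obtain ⟨n, inst, hn, e, a, he, ha, h⟩ := h
    refine IsProjWithoutFixed.of_tame hn (fun x => LinearMap.trace k V (a x) • e x)
      (fun g x v => ?_) (fun v => ?_) fun x hx => ?_
    · have h1 : a (g • x) = ρ g ∘ₗ a x ∘ₗ ρ g⁻¹ := by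
        ext v
        have := ha g x (ρ g⁻¹ v)
        rw [self_inv_apply] at this
        simpa using this
      have h2 : LinearMap.trace k V (a (g • x)) = LinearMap.trace k V (a x) := by
        rw [h1, LinearMap.trace_comp_comm', LinearMap.comp_assoc,
          ← Module.End.mul_eq_comp (ρ g⁻¹), ← map_mul, inv_mul_cancel, map_one]
        rfl
      simp [h2, he]
    · exact HasHomFrame.sum_trace h LinearMap.id v
    · rw [htr (a x) fun g v => ?_, zero_smul]
      have := ha g x v
      rwa [hx g] at this
  · rintro ⟨n, inst, hn, θ, hθ, hs⟩ ⟨c, hc, htr⟩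
    refine htr ?_
    have h1 : c = ∑ x, θ x ∘ₗ c := by
      ext v
      simp [LinearMap.sum_apply, hs]
    rw [h1, map_sum]
    refine sum_eq_zero_of_forall_notMem S hn _ fun g x => ?_
    have h2 : θ (g • x) ∘ₗ c = ρ g ∘ₗ (θ x ∘ₗ c) ∘ₗ ρ g⁻¹ := by
      ext v
      have := hθ g x (c (ρ g⁻¹ v))
      rw [hc, self_inv_apply] at this
      simpa [hc] using this
    rw [h2, LinearMap.trace_comp_comm', LinearMap.comp_assoc,
      ← Module.End.mul_eq_comp (ρ g⁻¹), ← map_mul, inv_mul_cancel, map_one]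
    rfl

theorem isCappedDade_iff [Finite G] [Fact p.Prime] [CharP k p] (S : Sylow p G)
    {V : Type u} [AddCommGroup V] [Module k V] (ρ : Representation k G V) :
    IsCappedDade p ρ ↔ Module.Finite k V ∧ IsTamePair (S : Subgroup G) ρ ρ ∧
      ∃ c : V →ₗ[k] V, (∀ g v, c (ρ g v) = ρ g (c v)) ∧ LinearMap.trace k V c ≠ 0 := by
  rw [IsCappedDade, isDade_iff S, and_assoc]
  refine and_congr_right fun hV => and_congr_right fun h => ?_
  exact hasSylowVertexComponent_iff_exists_trace S h

end Characterization

/-! ### Tensor identities and duals -/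

section PairsOfSummands

variable {k : Type*} [Field k] {G : Type*} [Group G]
  {V : Type*} [AddCommGroup V] [Module k V] {W : Type*} [AddCommGroup W] [Module k W]
  {U : Type*} [AddCommGroup U] [Module k U]

theorem IsSummand.of_linearEquiv {ρ : Representation k G V} {σ : Representation k G W}
    (e : V ≃ₗ[k] W) (he : ∀ g v, e (ρ g v) = σ g (e v)) : IsSummand ρ σ :=
  IsSummand.of_maps e.toLinearMap e.symm.toLinearMap he
    (fun g w => by
      obtain ⟨v, rfl⟩ := e.surjective w
      rw [← he]; simp)
    fun v => e.symm_apply_apply v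

theorem isSummand_tprod_comm (ρ : Representation k G V) (σ : Representation k G W) :
    IsSummand (ρ.tprod σ) (σ.tprod ρ) :=
  IsSummand.of_linearEquiv (TensorProduct.comm k V W) fun g v => by
    refine LinearMap.congr_fun (f := (TensorProduct.comm k V W).toLinearMap ∘ₗ ρ.tprod σ g)
      (g := σ.tprod ρ g ∘ₗ (TensorProduct.comm k V W).toLinearMap) (TensorProduct.ext' ?_) v
    intro v w
    simp

theorem isSummand_tprod_assoc (ρ : Representation k G V) (σ : Representation k G W)
    (τ : Representation k G U) : IsSummand ((ρ.tprod σ).tprod τ) (ρ.tprod (σ.tprod τ)) :=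
  IsSummand.of_linearEquiv (TensorProduct.assoc k V W U) fun g v => by
    refine LinearMap.congr_fun
      (f := (TensorProduct.assoc k V W U).toLinearMap ∘ₗ (ρ.tprod σ).tprod τ g)
      (g := ρ.tprod (σ.tprod τ) g ∘ₗ (TensorProduct.assoc k V W U).toLinearMap)
      (TensorProduct.ext_threefold ?_) v
    intro u v w
    simp

theorem isSummand_trivial_tprod (ρ : Representation k G V) :
    IsSummand ((Representation.trivial k G k).tprod ρ) ρ :=
  IsSummand.of_linearEquiv (TensorProduct.lid k V) fun g v => by
    refine LinearMap.congr_fun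
      (f := (TensorProduct.lid k V).toLinearMap ∘ₗ (Representation.trivial k G k).tprod ρ g)
      (g := ρ g ∘ₗ (TensorProduct.lid k V).toLinearMap) (TensorProduct.ext' ?_) v
    intro u v
    simp

theorem IsTamePair.of_hasTameFrame {S : Subgroup G} {ρ : Representation k G V}
    (h : HasTameFrame S ρ) : IsTamePair S (Representation.trivial k G k) ρ := by
  obtain ⟨n, inst, hn, e, φ, he, hφ, h⟩ := h
  refine ⟨n, inst, hn, fun x => LinearMap.toSpanSingleton k V (e x), φ, fun g x v => ?_,
    fun g x w => ?_, fun v w => ?_⟩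
  · simp [he]
  · simp [hφ]
  · simp only [LinearMap.toSpanSingleton_apply]
    have : ∀ x, φ x w ⊗ₜ[k] (v • e x) = v ⊗ₜ[k] (φ x w • e x) := fun x => by
      rw [TensorProduct.tmul_smul, TensorProduct.smul_tmul', TensorProduct.tmul_smul,
        TensorProduct.smul_tmul', smul_eq_mul, smul_eq_mul, mul_comm]
    rw [Finset.sum_congr rfl fun x _ => this x, ← TensorProduct.tmul_sum, h]

theorem IsTamePair.dual [Module.Finite k V] [Module.Finite k W] {S : Subgroup G}
    {ρ : Representation k G V} {σ : Representation k G W}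
    (h : IsTamePair S ρ σ) : IsTamePair S ρ.dual σ.dual := by
  obtain ⟨n, inst, hn, e, a, he, ha, h⟩ := h
  refine ⟨n, inst, hn, fun x => (a x).dualMap, fun x => (e x).dualMap, fun g x μ => ?_,
    fun g x μ => ?_, fun μ ν => ?_⟩
  · ext v
    have := ha g⁻¹ (g • x) v
    rw [inv_smul_smul] at this
    exact (congrArg μ this).symm
  · ext v
    have := he g⁻¹ (g • x) v
    rw [inv_smul_smul] at this
    exact (congrArg μ this).symm
  · refine tensor_ext_of_dual fun t => ?_
    obtain ⟨v, rfl⟩ := (Module.evalEquiv k V).surjective t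
    ext w
    have := congrArg ν (HasHomFrame.sum_apply h μ v w)
    simp only [map_sum, map_smul, smul_eq_mul] at this
    simp only [map_sum, LinearMap.rTensor_tmul, TensorProduct.lid_tmul, LinearMap.sum_apply,
      LinearMap.smul_apply, smul_eq_mul, Module.evalEquiv_apply, Module.Dual.eval_apply,
      LinearMap.dualMap_apply]
    rw [← this]
    exact Finset.sum_congr rfl fun x _ => mul_comm _ _

/-- Since `V* ⊗ V ≅ End V`, a tame frame of the endomorphisms is a tame frame of `V* ⊗ V`. This will
make the dual an inverse in the Dade group. -/
theorem IsTamePair.tprod_dual [Module.Finite k V] {S : Subgroup G} {ρ : Representation k G V}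
    (h : IsTamePair S ρ ρ) :
    IsTamePair (W := Module.Dual k V ⊗[k] V) S (Representation.trivial k G k)
      (ρ.dual.tprod ρ) := by
  refine IsTamePair.of_hasTameFrame ?_
  rw [← hasTameFrame_linHom_iff] at h
  obtain ⟨n, inst, hn, h⟩ := h
  refine ⟨n, inst, hn, h.of_isSummand
    (IsSummand.of_linearEquiv (dualTensorHomEquiv k V V) fun g t => ?_)⟩
  exact LinearMap.congr_fun (dualTensorHom_comm ρ ρ g) t

theorem IsTamePair.of_isSummand_left {S : Subgroup G} {ρ : Representation k G V}
    {σ : Representation k G W} (h : IsTamePair S σ σ) (hs : IsSummand ρ σ) : IsTamePair S ρ σ :=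
  h.of_isSummand hs (IsSummand.refl σ)

end PairsOfSummands

/-! ### The Dade group -/

section Group

variable {k : Type u} [Field k] {G : Type v} [Group G] {p : ℕ} [Finite G] [Fact p.Prime]
  [CharP k p]

theorem compatible_iff (S : Sylow p G) (M N : CappedDadeModule k G p) :
    Compatible M N ↔ IsTamePair (S : Subgroup G) M.ρ N.ρ := by
  obtain ⟨hM, hM', -⟩ := (isCappedDade_iff S M.ρ).1 M.isCappedDade
  obtain ⟨hN, hN', -⟩ := (isCappedDade_iff S N.ρ).1 N.isCappedDade
  rw [Compatible, isDade_iff S, IsTamePair.prod_self_iff]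
  exact ⟨fun h => h.2.2.1, fun h => ⟨inferInstance, hM', h, hN'⟩⟩

variable (k G p) in
theorem compatible_equivalence : Equivalence (Compatible (k := k) (G := G) (p := p)) := by
  obtain ⟨S⟩ : Nonempty (Sylow p G) := inferInstance
  refine ⟨fun M => ?_, fun {M N} h => ?_, fun {M N L} h h' => ?_⟩
  · exact (compatible_iff S M M).2 ((isCappedDade_iff S M.ρ).1 M.isCappedDade).2.1
  · rw [compatible_iff S] at h ⊢
    exact h.symm
  · rw [compatible_iff S] at h h' ⊢
    -- Cappedness of the middle module supplies the endomorphism of nonzero trace.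
    obtain ⟨hN, -, c, hc, htr⟩ := (isCappedDade_iff S N.ρ).1 N.isCappedDade
    have hL := ((isCappedDade_iff S L.ρ).1 L.isCappedDade).1
    exact h.trans h' c hc htr

theorem IsCappedDade.tprod {V W : Type u} [AddCommGroup V] [Module k V] [AddCommGroup W]
    [Module k W] {ρ : Representation k G V} {σ : Representation k G W} (h : IsCappedDade p ρ)
    (h' : IsCappedDade p σ) : IsCappedDade p (ρ.tprod σ) := by
  obtain ⟨S⟩ : Nonempty (Sylow p G) := inferInstance
  rw [isCappedDade_iff S] at h h' ⊢
  obtain ⟨hV, h1, c, hc, htr⟩ := h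
  obtain ⟨hW, h1', c', hc', htr'⟩ := h'
  refine ⟨inferInstance, h1.tprod h1', TensorProduct.map c c', fun g t => ?_, ?_⟩
  · induction t with
    | zero => simp
    | add v v' hv hv' => rw [map_add, map_add, map_add, map_add, hv, hv']
    | tmul v v' => simp [hc, hc']
  · rw [LinearMap.trace_tensorProduct']
    exact mul_ne_zero htr htr'

theorem IsCappedDade.dual {V : Type u} [AddCommGroup V] [Module k V]
    {ρ : Representation k G V} (h : IsCappedDade p ρ) : IsCappedDade p ρ.dual := by
  obtain ⟨S⟩ : Nonempty (Sylow p G) := inferInstance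
  rw [isCappedDade_iff S] at h ⊢
  obtain ⟨hV, h1, c, hc, htr⟩ := h
  refine ⟨inferInstance, h1.dual, c.dualMap, fun g μ => ?_, ?_⟩
  · ext v
    exact congrArg μ (hc g⁻¹ v).symm
  · rw [LinearMap.dualMap_def, LinearMap.trace_transpose']
    exact htr

variable (k G p) in
theorem isCappedDade_trivial : IsCappedDade p (Representation.trivial k G k) := by
  obtain ⟨S⟩ : Nonempty (Sylow p G) := inferInstance
  rw [isCappedDade_iff S]
  refine ⟨inferInstance, IsTamePair.of_hasTameFrame ?_, LinearMap.id, fun g v => rfl, by simp⟩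
  let _ : MulAction G Unit :=
    { smul := fun _ x => x, one_smul := fun _ => rfl, mul_smul := fun _ _ _ => rfl }
  exact HasTameFrame.intro Unit (fun _ _ _ => rfl)
    ⟨fun _ => 1, fun _ => LinearMap.id, fun _ _ => rfl, fun _ _ _ => rfl, fun v => by simp⟩

theorem DadeGroup.mk_eq_mk (S : Sylow p G) {V W : Type u} [AddCommGroup V] [Module k V]
    [AddCommGroup W] [Module k W] {ρ : Representation k G V} {σ : Representation k G W}
    (hρ : IsCappedDade p ρ) (hσ : IsCappedDade p σ) (h : IsTamePair (S : Subgroup G) ρ σ) :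
    DadeGroup.mk ρ hρ = DadeGroup.mk σ hσ :=
  Quot.sound ((compatible_iff S ⟨V, ρ, hρ⟩ ⟨W, σ, hσ⟩).2 h)

theorem DadeGroup.mk_eq_mk_of_isSummand {V W : Type u} [AddCommGroup V] [Module k V]
    [AddCommGroup W] [Module k W] {ρ : Representation k G V} {σ : Representation k G W}
    (hρ : IsCappedDade p ρ) (hσ : IsCappedDade p σ) (h : IsSummand ρ σ) :
    DadeGroup.mk ρ hρ = DadeGroup.mk σ hσ := by
  obtain ⟨S⟩ : Nonempty (Sylow p G) := inferInstance
  exact mk_eq_mk S hρ hσ (((isCappedDade_iff S σ).1 hσ).2.1.of_isSummand_left h)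

noncomputable scoped instance : Add (DadeGroup k G p) where
  add := Quot.map₂ (fun M N => ⟨_, M.ρ.tprod N.ρ, M.isCappedDade.tprod N.isCappedDade⟩)
    (fun M N N' h => by
      obtain ⟨S⟩ : Nonempty (Sylow p G) := inferInstance
      rw [compatible_iff S] at h ⊢
      exact ((isCappedDade_iff S M.ρ).1 M.isCappedDade).2.1.tprod h)
    (fun M M' N h => by
      obtain ⟨S⟩ : Nonempty (Sylow p G) := inferInstance
      rw [compatible_iff S] at h ⊢
      exact h.tprod ((isCappedDade_iff S N.ρ).1 N.isCappedDade).2.1)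

noncomputable scoped instance : Zero (DadeGroup k G p) :=
  ⟨DadeGroup.mk _ (isCappedDade_trivial k G p)⟩

noncomputable scoped instance : Neg (DadeGroup k G p) where
  neg := Quot.map (fun M => ⟨_, M.ρ.dual, M.isCappedDade.dual⟩) fun M N h => by
    obtain ⟨S⟩ : Nonempty (Sylow p G) := inferInstance
    have := ((isCappedDade_iff S M.ρ).1 M.isCappedDade).1
    have := ((isCappedDade_iff S N.ρ).1 N.isCappedDade).1
    rw [compatible_iff S] at h ⊢
    exact h.dual

/-- The Dade group, with addition induced by the tensor product. -/
noncomputable scoped instance instAddCommGroupDadeGroup : AddCommGroup (DadeGroup k G p) where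
  __ := AddGroup.ofLeftAxioms (G := DadeGroup k G p)
    (by
      rintro ⟨M⟩ ⟨N⟩ ⟨L⟩
      exact DadeGroup.mk_eq_mk_of_isSummand ((M.isCappedDade.tprod N.isCappedDade).tprod
        L.isCappedDade) (M.isCappedDade.tprod (N.isCappedDade.tprod L.isCappedDade))
        (isSummand_tprod_assoc M.ρ N.ρ L.ρ))
    (by
      rintro ⟨M⟩
      exact DadeGroup.mk_eq_mk_of_isSummand ((isCappedDade_trivial k G p).tprod M.isCappedDade)
        M.isCappedDade (isSummand_trivial_tprod M.ρ))
    (by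
      rintro ⟨M⟩
      obtain ⟨S⟩ : Nonempty (Sylow p G) := inferInstance
      obtain ⟨hM, hM', -⟩ := (isCappedDade_iff S M.ρ).1 M.isCappedDade
      exact DadeGroup.mk_eq_mk S (M.isCappedDade.dual.tprod M.isCappedDade)
        (isCappedDade_trivial k G p) hM'.tprod_dual.symm)
  add_comm := by
    rintro ⟨M⟩ ⟨N⟩
    exact DadeGroup.mk_eq_mk_of_isSummand (M.isCappedDade.tprod N.isCappedDade)
      (N.isCappedDade.tprod M.isCappedDade) (isSummand_tprod_comm M.ρ N.ρ)

theorem DadeGroup.mk_add_mk {V W : Type u} [AddCommGroup V] [Module k V]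
    [AddCommGroup W] [Module k W] {ρ : Representation k G V} {σ : Representation k G W}
    (hρ : IsCappedDade p ρ) (hσ : IsCappedDade p σ) :
    DadeGroup.mk ρ hρ + DadeGroup.mk σ hσ = DadeGroup.mk (ρ.tprod σ) (hρ.tprod hσ) := rfl

end Group

/-! ### Relative syzygies as functions with sum zero -/

section Syzygy

variable {k : Type*} [Field k] {G : Type*} [Group G]
  {V : Type*} [AddCommGroup V] [Module k V] {W : Type*} [AddCommGroup W] [Module k W]

/-- The representation on functions on a `G`-set with values in a representation. -/
def funRep (X : Type*) [MulAction G X] (σ : Representation k G W) :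
    Representation k G (X → W) where
  toFun g := LinearMap.pi fun x => σ g ∘ₗ LinearMap.proj (g⁻¹ • x)
  map_one' := by ext; simp
  map_mul' g h := by ext; simp [mul_smul]

/-- The functions on a `G`-set with sum zero. -/
def sumZero (X : Type*) [Fintype X] [MulAction G X] (σ : Representation k G W) :
    Subrepresentation (funRep X σ) where
  toSubmodule := LinearMap.ker (∑ x, (LinearMap.proj x : (X → W) →ₗ[k] W))
  apply_mem_toSubmodule g f hf := by
    simp only [LinearMap.mem_ker, LinearMap.sum_apply, LinearMap.proj_apply] at hf ⊢
    change ∑ x, σ g (f (g⁻¹ • x)) = 0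
    rw [← map_sum, Fintype.sum_equiv (MulAction.toPerm g⁻¹) (fun x => f (g⁻¹ • x)) f
      fun _ => rfl, hf, map_zero]

/-- The relative syzygy of `σ` with respect to `X`: the kernel of `k[X] ⊗ W → W`, in terms of
functions. -/
abbrev syz (X : Type*) [Fintype X] [MulAction G X] (σ : Representation k G W) :
    Representation k G (sumZero X σ).toSubmodule :=
  (sumZero X σ).toRepresentation

variable {X : Type*} [Fintype X] [MulAction G X] {σ : Representation k G W}

theorem mem_sumZero {f : X → W} : f ∈ (sumZero X σ).toSubmodule ↔ ∑ x, f x = 0 := by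
  simp [sumZero]

theorem sumZero_sum (f : (sumZero X σ).toSubmodule) : ∑ x, f.1 x = 0 := mem_sumZero.1 f.2

theorem syz_apply (g : G) (f : (sumZero X σ).toSubmodule) (x : X) :
    (syz X σ g f).1 x = σ g (f.1 (g⁻¹ • x)) := rfl

theorem sumZero_ext {f f' : (sumZero X σ).toSubmodule} (h : ∀ x, f.1 x = f'.1 x) : f = f' :=
  Subtype.ext (funext h)

/-- The element `δ_x ⊗ w - δ_y ⊗ w`. -/
def diffElt [DecidableEq X] (σ : Representation k G W) (x y : X) (w : W) :
    (sumZero X σ).toSubmodule :=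
  ⟨Pi.single x w - Pi.single y w, mem_sumZero.2 (by simp)⟩

/-- The inverse sends `f` to `∑ (δ_x - δ_{x₀}) ⊗ f x`; the base point `x₀` does not matter because
`f` has sum zero. -/
theorem exists_tprod_syz_equiv [Nonempty X] (σ : Representation k G W) :
    ∃ e : ((sumZero X (Representation.trivial k G k)).toSubmodule ⊗[k] W) ≃ₗ[k]
        (sumZero X σ).toSubmodule,
      ∀ g t, e ((syz X (Representation.trivial k G k)).tprod σ g t) = syz X σ g (e t) := by
  classical
  obtain ⟨x₀⟩ := ‹Nonempty X›
  let i : (sumZero X (Representation.trivial k G k)).toSubmodule ⊗[k] W →ₗ[k]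
      (sumZero X σ).toSubmodule := TensorProduct.lift (LinearMap.mk₂ k
    (fun d w => ⟨fun x => d.1 x • w, mem_sumZero.2 (by
      rw [← Finset.sum_smul, sumZero_sum d, zero_smul])⟩)
    (fun d d' w => sumZero_ext fun x => add_smul _ _ _)
    (fun c d w => sumZero_ext fun x => mul_smul _ _ _)
    (fun d w w' => sumZero_ext fun x => smul_add _ _ _)
    (fun c d w => sumZero_ext fun x => smul_comm _ _ _))
  have hi : ∀ d w x, (i (d ⊗ₜ w)).1 x = d.1 x • w := fun _ _ _ => rfl
  let j : (sumZero X σ).toSubmodule →ₗ[k]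
      (sumZero X (Representation.trivial k G k)).toSubmodule ⊗[k] W :=
    ∑ x, TensorProduct.mk k _ _ (diffElt (Representation.trivial k G k) x x₀ 1) ∘ₗ
      LinearMap.proj x ∘ₗ (sumZero X σ).toSubmodule.subtype
  have hj : ∀ f, j f = ∑ x, diffElt (Representation.trivial k G k) x x₀ 1 ⊗ₜ f.1 x := fun f => by
    simp [j, LinearMap.sum_apply]
  have hsum : ∀ d : (sumZero X (Representation.trivial k G k)).toSubmodule,
      ∑ x, d.1 x • diffElt (Representation.trivial k G k) x x₀ 1 = d := by
    intro d
    refine Subtype.ext ?_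
    rw [Submodule.coe_sum]
    simp only [Submodule.coe_smul, diffElt, smul_sub, Finset.sum_sub_distrib]
    rw [← Finset.sum_smul, sumZero_sum d, zero_smul, sub_zero]
    ext x
    simp [Pi.single_apply]
  have hji : ∀ t, j (i t) = t := by
    intro t
    refine LinearMap.congr_fun (f := j ∘ₗ i) (g := LinearMap.id) (TensorProduct.ext' ?_) t
    intro d w
    rw [LinearMap.comp_apply, hj]
    simp only [hi, ← TensorProduct.smul_tmul, ← TensorProduct.sum_tmul]
    rw [hsum]
    rfl
  have hij : ∀ f, i (j f) = f := by
    intro f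
    refine Subtype.ext ?_
    rw [hj, map_sum, Submodule.coe_sum]
    ext y
    simp only [Finset.sum_apply, hi, diffElt, Pi.sub_apply, sub_smul, Finset.sum_sub_distrib,
      Pi.single_apply, ite_smul, one_smul, zero_smul]
    split_ifs with h
    · subst h
      simp [sumZero_sum f]
    · simp
  refine ⟨LinearEquiv.ofLinearMap i j (LinearMap.ext hij) (LinearMap.ext hji), fun g t => ?_⟩
  change i _ = syz X σ g (i t)
  induction t with
  | zero => simp
  | add t t' h h' => rw [map_add, map_add, map_add, map_add, h, h']
  | tmul d w => exact sumZero_ext fun x => (map_smul (σ g) _ _).symm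

theorem isSummand_tprod_syz [Nonempty X] (σ : Representation k G W) :
    IsSummand (U := (sumZero X (Representation.trivial k G k)).toSubmodule ⊗[k] W)
      (V := (sumZero X σ).toSubmodule)
      ((syz X (Representation.trivial k G k)).tprod σ) (syz X σ) := by
  obtain ⟨e, he⟩ := exists_tprod_syz_equiv (X := X) σ
  exact IsSummand.of_linearEquiv e he

theorem isSummand_syz_tprod [Nonempty X] (σ : Representation k G W) :
    IsSummand (U := (sumZero X σ).toSubmodule)
      (V := (sumZero X (Representation.trivial k G k)).toSubmodule ⊗[k] W)
      (syz X σ) ((syz X (Representation.trivial k G k)).tprod σ) := by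
  obtain ⟨e, he⟩ := exists_tprod_syz_equiv (X := X) σ
  refine IsSummand.of_linearEquiv e.symm fun g d => ?_
  rw [LinearEquiv.symm_apply_eq, he, LinearEquiv.apply_symm_apply]

theorem IsSummand.tprod {V' W' : Type*} [AddCommGroup V'] [Module k V'] [AddCommGroup W']
    [Module k W'] {ρ : Representation k G V} {ρ' : Representation k G V'}
    {σ : Representation k G W} {σ' : Representation k G W'} (h : IsSummand ρ ρ')
    (h' : IsSummand σ σ') : IsSummand (ρ.tprod σ) (ρ'.tprod σ') := by
  obtain ⟨i, r, hi, hr, hir⟩ := h.exists_maps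
  obtain ⟨j, s, hj, hs, hjs⟩ := h'.exists_maps
  refine IsSummand.of_maps (TensorProduct.map i j) (TensorProduct.map r s) (fun g t => ?_)
    (fun g t => ?_) fun t => ?_
  · induction t with
    | zero => simp
    | add t t' h h' => rw [map_add, map_add, map_add, map_add, h, h']
    | tmul d w => simp [hi, hj]
  · induction t with
    | zero => simp
    | add t t' h h' => rw [map_add, map_add, map_add, map_add, h, h']
    | tmul d w => simp [hr, hs]
  · induction t with
    | zero => simp
    | add t t' h h' => rw [map_add, map_add, h, h']
    | tmul d w => simp [hir, hjs]

theorem tensor_ext_of_coord {Y : Type*} [Finite Y] {A : Submodule k (Y → k)} {z z' : A ⊗[k] W}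
    (h : ∀ y, TensorProduct.lid k W ((LinearMap.proj y ∘ₗ A.subtype).rTensor W z) =
      TensorProduct.lid k W ((LinearMap.proj y ∘ₗ A.subtype).rTensor W z')) : z = z' := by
  classical
  have := Fintype.ofFinite Y
  refine tensor_ext_of_dual fun μ => ?_
  obtain ⟨ν, hν⟩ := LinearMap.exists_extend μ
  have h1 : μ = ∑ y, ν (Pi.single y 1) • (LinearMap.proj y ∘ₗ A.subtype) := by
    rw [← hν]
    ext a
    conv_lhs => rw [LinearMap.comp_apply, ← Finset.univ_sum_single (A.subtype a), map_sum]
    simp only [LinearMap.sum_apply, LinearMap.smul_apply, LinearMap.comp_apply,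
      LinearMap.proj_apply, smul_eq_mul]
    refine Finset.sum_congr rfl fun y _ => ?_
    rw [mul_comm, ← smul_eq_mul, ← map_smul, ← Pi.single_smul', smul_eq_mul, mul_one]
  have h2 : ∀ z : A ⊗[k] W, TensorProduct.lid k W (μ.rTensor W z) = ∑ y, ν (Pi.single y 1) •
      TensorProduct.lid k W ((LinearMap.proj y ∘ₗ A.subtype).rTensor W z) := by
    intro z
    rw [h1, ← LinearMap.coe_rTensorHom, map_sum, LinearMap.sum_apply, map_sum]
    simp
  rw [h2, h2]
  simp only [h]

variable {Y : Type*} [Fintype Y] [MulAction G Y]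

/-- Relative syzygies of two `G`-sets form a tame pair as soon as each of the two augmentation
maps factors equivariantly through the other one. -/
theorem isTamePair_syz {S : Subgroup G} (hX : ∀ x : X, x ∉ MulAction.fixedPoints S X)
    (u : Y → X → k) (hu : ∀ (g : G) y x, u (g • y) (g • x) = u y x) (hu1 : ∀ y, ∑ x, u y x = 1)
    (v : X → Y → k) (hv : ∀ (g : G) x y, v (g • x) (g • y) = v x y) (hv1 : ∀ x, ∑ y, v x y = 1) :
    IsTamePair S (syz Y (Representation.trivial k G k)) (syz X (Representation.trivial k G k)) := by
  classical
  let _ : MulAction G Unit :=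
    { smul := fun _ x => x, one_smul := fun _ => rfl, mul_smul := fun _ _ _ => rfl }
  have hu' : ∀ (g : G) y x, u (g • y) x = u y (g⁻¹ • x) := fun g y x => by
    conv_lhs => rw [← smul_inv_smul g x, hu]
  have hv' : ∀ (g : G) x y, v (g • x) y = v x (g⁻¹ • y) := fun g x y => by
    conv_lhs => rw [← smul_inv_smul g y, hv]
  -- `b y x = δ_x - u_y` and `c y x = δ_y - v_x` are differences of elements of augmentation 1.
  let b : Y → X → (sumZero X (Representation.trivial k G k)).toSubmodule := fun y x =>
    ⟨Pi.single x 1 - u y, mem_sumZero.2 (by simp [hu1])⟩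
  let c : Y → X → (sumZero Y (Representation.trivial k G k)).toSubmodule := fun y x =>
    ⟨Pi.single y 1 - v x, mem_sumZero.2 (by simp [hv1])⟩
  let e₁ : (sumZero Y (Representation.trivial k G k)).toSubmodule →ₗ[k]
      (sumZero X (Representation.trivial k G k)).toSubmodule :=
    { toFun := fun d => ⟨fun x => ∑ y, d.1 y * u y x, mem_sumZero.2 (by
        rw [Finset.sum_comm]
        simp only [← Finset.mul_sum, hu1, mul_one, sumZero_sum])⟩
      map_add' := fun d d' => sumZero_ext fun x => by
        simp [add_mul, Finset.sum_add_distrib]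
      map_smul' := fun t d => sumZero_ext fun x => by
        simp [Finset.mul_sum, mul_assoc] }
  let a₁ : (sumZero X (Representation.trivial k G k)).toSubmodule →ₗ[k]
      (sumZero Y (Representation.trivial k G k)).toSubmodule :=
    { toFun := fun s => ⟨fun y => ∑ x, s.1 x * v x y, mem_sumZero.2 (by
        rw [Finset.sum_comm]
        simp only [← Finset.mul_sum, hv1, mul_one, sumZero_sum])⟩
      map_add' := fun d d' => sumZero_ext fun x => by
        simp [add_mul, Finset.sum_add_distrib]
      map_smul' := fun t d => sumZero_ext fun x => by
        simp [Finset.mul_sum, mul_assoc] }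
  -- Expand `∑ d_y s_x (δ_y - v_x) ⊗ (δ_x - u_y)`: the mixed terms die because `d` and `s` have sum
  -- zero, leaving `d ⊗ s + a₁ s ⊗ e₁ d`. The single extra fixed index carries `e₁` and `-a₁` to
  -- cancel the last term.
  refine IsTamePair.intro (Unit ⊕ Y × X) (IsTame.sum (fun _ _ _ => rfl)
    (IsTame.of_forall_notMem fun x hx => hX x.2 fun s => congrArg Prod.snd (hx s)))
    ⟨Sum.elim (fun _ => e₁) fun z =>
      (LinearMap.proj z.1 ∘ₗ Submodule.subtype _).smulRight (b z.1 z.2),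
    Sum.elim (fun _ => -a₁) fun z =>
      (LinearMap.proj z.2 ∘ₗ Submodule.subtype _).smulRight (c z.1 z.2), ?_, ?_, fun d s => ?_⟩
  · rintro g (z | ⟨y, x⟩) d
    · refine sumZero_ext fun x => ?_
      change ∑ y, d.1 (g⁻¹ • y) * u y x = ∑ y, d.1 y * u y (g⁻¹ • x)
      refine Fintype.sum_equiv (MulAction.toPerm g⁻¹) _ _ fun y => ?_
      rw [MulAction.toPerm_apply, hu]
    · refine sumZero_ext fun x' => ?_
      change d.1 (g⁻¹ • g • y) * ((Pi.single (g • x) 1 : X → k) x' - u (g • y) x') =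
        d.1 y * ((Pi.single x 1 : X → k) (g⁻¹ • x') - u y (g⁻¹ • x'))
      rw [inv_smul_smul, hu']
      simp only [Pi.single_apply, inv_smul_eq_iff]
  · rintro g (z | ⟨y, x⟩) s
    · refine sumZero_ext fun y => ?_
      change -∑ x, s.1 (g⁻¹ • x) * v x y = -∑ x, s.1 x * v x (g⁻¹ • y)
      congr 1
      refine Fintype.sum_equiv (MulAction.toPerm g⁻¹) _ _ fun x => ?_
      rw [MulAction.toPerm_apply, hv]
    · refine sumZero_ext fun y' => ?_
      change s.1 (g⁻¹ • g • x) * ((Pi.single (g • y) 1 : Y → k) y' - v (g • x) y') =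
        s.1 x * ((Pi.single y 1 : Y → k) (g⁻¹ • y') - v x (g⁻¹ • y'))
      rw [inv_smul_smul, hv']
      simp only [Pi.single_apply, inv_smul_eq_iff]
  · refine tensor_ext_of_coord fun y₀ => ?_
    simp only [map_sum, LinearMap.rTensor_tmul, TensorProduct.lid_tmul]
    refine Subtype.ext ?_
    rw [Submodule.coe_sum]
    ext x₀
    rw [Finset.sum_apply, Fintype.sum_sum_type, Fintype.sum_prod_type]
    change ∑ _ : Unit, (-∑ x, s.1 x * v x y₀) * (∑ y, d.1 y * u y x₀) +
      ∑ y, ∑ x, (s.1 x * ((Pi.single y 1 : Y → k) y₀ - v x y₀)) *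
        (d.1 y * ((Pi.single x 1 : X → k) x₀ - u y x₀)) = d.1 y₀ * s.1 x₀
    have key : ∀ y, ∑ x, (s.1 x * ((Pi.single y 1 : Y → k) y₀ - v x y₀)) *
        (d.1 y * ((Pi.single x 1 : X → k) x₀ - u y x₀)) =
        d.1 y * (Pi.single y 1 : Y → k) y₀ * s.1 x₀ - d.1 y * (s.1 x₀ * v x₀ y₀) +
          (∑ x, s.1 x * v x y₀) * (d.1 y * u y x₀) := by
      intro y
      have h1 : ∑ x, s.1 x * (Pi.single x 1 : X → k) x₀ = s.1 x₀ := by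
        simp [Pi.single_apply]
      have h2 : ∑ x, s.1 x * v x y₀ * (Pi.single x 1 : X → k) x₀ = s.1 x₀ * v x₀ y₀ := by
        simp [Pi.single_apply]
      have h3 := sumZero_sum s
      have : ∀ x, (s.1 x * ((Pi.single y 1 : Y → k) y₀ - v x y₀)) *
          (d.1 y * ((Pi.single x 1 : X → k) x₀ - u y x₀)) =
          d.1 y * (Pi.single y 1 : Y → k) y₀ * (s.1 x * (Pi.single x 1 : X → k) x₀) -
          d.1 y * (s.1 x * v x y₀ * (Pi.single x 1 : X → k) x₀) -
          d.1 y * (Pi.single y 1 : Y → k) y₀ * u y x₀ * s.1 x +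
          d.1 y * u y x₀ * (s.1 x * v x y₀) := fun x => by ring
      rw [Finset.sum_congr rfl fun x _ => this x, Finset.sum_add_distrib, Finset.sum_sub_distrib,
        Finset.sum_sub_distrib, ← Finset.mul_sum, ← Finset.mul_sum, ← Finset.mul_sum,
        ← Finset.mul_sum, h1, h2, h3]
      ring
    have h1 : ∑ y, d.1 y * (Pi.single y 1 : Y → k) y₀ * s.1 x₀ = d.1 y₀ * s.1 x₀ := by
      simp [Pi.single_apply]
    have h2 : ∑ y, d.1 y * (s.1 x₀ * v x₀ y₀) = 0 := by
      rw [← Finset.sum_mul, sumZero_sum d, zero_mul]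
    rw [Finset.sum_congr rfl fun y _ => key y, Finset.sum_add_distrib, Finset.sum_sub_distrib,
      h1, h2, Finset.univ_unique, Finset.sum_singleton, Finset.mul_sum, sub_zero]
    simp only [neg_mul, Finset.sum_neg_distrib]
    ring

/-- `Δ(X) ⊗ Δ(Y)` is a summand of `Δ(X × Y) ⊗ Δ(X ⊔ Y)`. -/
theorem isSummand_syz_syz :
    IsSummand (U := (sumZero X (syz Y (Representation.trivial k G k))).toSubmodule)
      (V := (sumZero (X × Y) (syz (X ⊕ Y) (Representation.trivial k G k))).toSubmodule)
      (syz X (syz Y (Representation.trivial k G k)))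
      (syz (X × Y) (syz (X ⊕ Y) (Representation.trivial k G k))) := by
  classical
  let dd : X × Y → (sumZero (X ⊕ Y) (Representation.trivial k G k)).toSubmodule := fun z =>
    diffElt _ (Sum.inl z.1) (Sum.inr z.2) 1
  have hl : ∀ z x, (dd z).1 (Sum.inl x) = if x = z.1 then 1 else 0 := fun z x => by
    simp [dd, diffElt, Pi.single_apply]
  have hr : ∀ z y, (dd z).1 (Sum.inr y) = if y = z.2 then -1 else 0 := fun z y => by
    simp only [dd, diffElt, Pi.single_apply, Pi.sub_apply]
    by_cases h : y = z.2 <;> simp [h]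
  have hcol : ∀ (f : (sumZero X (syz Y (Representation.trivial k G k))).toSubmodule) y,
      ∑ x, (f.1 x).1 y = 0 := by
    intro f y
    have := congrFun (congrArg Subtype.val (sumZero_sum f)) y
    rw [Submodule.coe_sum, Finset.sum_apply] at this
    exact this
  have hcol' : ∀ (F : (sumZero (X × Y) (syz (X ⊕ Y)
      (Representation.trivial k G k))).toSubmodule) w, ∑ x, ∑ y, (F.1 (x, y)).1 w = 0 := by
    intro F w
    have := congrFun (congrArg Subtype.val (sumZero_sum F)) w
    rw [Submodule.coe_sum, Finset.sum_apply, Fintype.sum_prod_type] at this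
    exact this
  let i : (sumZero X (syz Y (Representation.trivial k G k))).toSubmodule →ₗ[k]
      (sumZero (X × Y) (syz (X ⊕ Y) (Representation.trivial k G k))).toSubmodule :=
    { toFun := fun f => ⟨fun z => (f.1 z.1).1 z.2 • dd z, mem_sumZero.2 (by
        refine Subtype.ext ?_
        rw [Submodule.coe_sum, Fintype.sum_prod_type]
        ext w
        simp only [Finset.sum_apply, Submodule.coe_smul, Pi.smul_apply, smul_eq_mul]
        rcases w with x | y
        · simp [hl, sumZero_sum]
        · simp [hr, hcol])⟩
      map_add' := fun f f' => sumZero_ext fun z => add_smul _ _ _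
      map_smul' := fun c f => sumZero_ext fun z => mul_smul _ _ _ }
  have hi : ∀ f z w, ((i f).1 z).1 w = (f.1 z.1).1 z.2 * (dd z).1 w := fun _ _ _ => rfl
  -- On the image of `i`, where `F (x, y) = f (x, y) (δ_x - δ_y)`, each of the first two signed
  -- terms gives `f (x, y)` and the third removes one copy. No division by 2 is needed, so
  -- characteristic 2 is included.
  let q : (sumZero (X × Y) (syz (X ⊕ Y) (Representation.trivial k G k))).toSubmodule →
      X → Y → k := fun F x y => ∑ x₀, (F.1 (x₀, y)).1 (Sum.inl x) -
        ∑ y₀, (F.1 (x, y₀)).1 (Sum.inr y) - ∑ x', (F.1 (x, y)).1 (Sum.inl x')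
  have hz : ∀ (F : (sumZero (X × Y) (syz (X ⊕ Y) (Representation.trivial k G k))).toSubmodule) z,
      ∑ x, (F.1 z).1 (Sum.inl x) + ∑ y, (F.1 z).1 (Sum.inr y) = 0 := by
    intro F z
    rw [← Fintype.sum_sum_type]
    exact sumZero_sum (F.1 z)
  let r : (sumZero (X × Y) (syz (X ⊕ Y) (Representation.trivial k G k))).toSubmodule →ₗ[k]
      (sumZero X (syz Y (Representation.trivial k G k))).toSubmodule :=
    { toFun := fun F => ⟨fun x => ⟨fun y => q F x y, mem_sumZero.2 (by
          simp only [q, Finset.sum_sub_distrib]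
          have h1 := hcol' F (Sum.inl x)
          rw [Finset.sum_comm] at h1
          rw [h1, Finset.sum_comm, zero_sub, ← neg_add', neg_eq_zero, ← Finset.sum_add_distrib]
          exact Finset.sum_eq_zero fun y _ => by rw [add_comm]; exact hz F _)⟩,
        mem_sumZero.2 (by
          refine sumZero_ext fun y => ?_
          rw [Submodule.coe_sum, Finset.sum_apply]
          change ∑ x, q F x y = 0
          simp only [q, Finset.sum_sub_distrib]
          rw [hcol' F (Sum.inr y), Finset.sum_comm]
          simp)⟩
      map_add' := fun F F' => sumZero_ext fun x => sumZero_ext fun y => by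
        change q (F + F') x y = q F x y + q F' x y
        simp only [q, Submodule.coe_add, Pi.add_apply, Finset.sum_add_distrib]
        ring
      map_smul' := fun c F => sumZero_ext fun x => sumZero_ext fun y => by
        change q (c • F) x y = c * q F x y
        simp only [q, Submodule.coe_smul, Pi.smul_apply, smul_eq_mul, mul_sub, Finset.mul_sum] }
  refine IsSummand.of_maps i r (fun g f => ?_) (fun g F => ?_) fun f => ?_
  · refine sumZero_ext fun z => sumZero_ext fun w => ?_
    rw [hi, syz_apply, syz_apply, syz_apply, syz_apply, hi]
    change (f.1 (g⁻¹ • z.1)).1 (g⁻¹ • z.2) * _ = (f.1 (g⁻¹ • z.1)).1 (g⁻¹ • z.2) * _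
    congr 1
    rcases w with x | y
    · rw [hl]
      change _ = (dd (g⁻¹ • z)).1 (Sum.inl (g⁻¹ • x))
      rw [hl]
      simp only [Prod.smul_fst, smul_left_cancel_iff]
    · rw [hr]
      change _ = (dd (g⁻¹ • z)).1 (Sum.inr (g⁻¹ • y))
      rw [hr]
      simp only [Prod.smul_snd, smul_left_cancel_iff]
  · refine sumZero_ext fun x => sumZero_ext fun y => ?_
    change ∑ x₀, (F.1 (g⁻¹ • x₀, g⁻¹ • y)).1 (Sum.inl (g⁻¹ • x)) -
        ∑ y₀, (F.1 (g⁻¹ • x, g⁻¹ • y₀)).1 (Sum.inr (g⁻¹ • y)) -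
        ∑ x', (F.1 (g⁻¹ • x, g⁻¹ • y)).1 (Sum.inl (g⁻¹ • x')) =
      ∑ x₀, (F.1 (x₀, g⁻¹ • y)).1 (Sum.inl (g⁻¹ • x)) -
        ∑ y₀, (F.1 (g⁻¹ • x, y₀)).1 (Sum.inr (g⁻¹ • y)) -
        ∑ x', (F.1 (g⁻¹ • x, g⁻¹ • y)).1 (Sum.inl x')
    refine congrArg₂ _ (congrArg₂ _ ?_ ?_) ?_
    · exact Fintype.sum_equiv (MulAction.toPerm g⁻¹ : Equiv.Perm X) _ _ fun _ => rfl
    · exact Fintype.sum_equiv (MulAction.toPerm g⁻¹ : Equiv.Perm Y) _ _ fun _ => rfl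
    · exact Fintype.sum_equiv (MulAction.toPerm g⁻¹ : Equiv.Perm X) _ _ fun _ => rfl
  · refine sumZero_ext fun x => sumZero_ext fun y => ?_
    change ∑ x₀, ((i f).1 (x₀, y)).1 (Sum.inl x) - ∑ y₀, ((i f).1 (x, y₀)).1 (Sum.inr y) -
      ∑ x', ((i f).1 (x, y)).1 (Sum.inl x') = (f.1 x).1 y
    simp [hi, hl, hr]

end Syzygy

/-! ### Equivariant maps and equivariant weights -/

section EquivariantMaps

/-- It suffices to choose the image of one representative per orbit, subject to the inclusion of
stabilizers. -/
theorem exists_equivariant_map {H X Y : Type*} [Group H] [MulAction H X] [MulAction H Y]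
    (h : ∀ y : Y, ∃ x : X, ∀ s : H, s • y = y → s • x = x) :
    ∃ m : Y → X, ∀ (s : H) y, m (s • y) = s • m y := by
  classical
  choose a ha using h
  let b : Y → Y := fun y => (Quotient.mk (MulAction.orbitRel H Y) y).out
  have hb : ∀ (s : H) y, b (s • y) = b y := fun s y =>
    congrArg Quotient.out (Quotient.sound (s := MulAction.orbitRel H Y) ⟨s, rfl⟩)
  have hex : ∀ y, ∃ t : H, t • b y = y := fun y => by
    obtain ⟨t, ht⟩ := Quotient.mk_out (s := MulAction.orbitRel H Y) y
    exact ⟨t⁻¹, by rw [inv_smul_eq_iff]; exact ht.symm⟩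
  choose t ht using hex
  refine ⟨fun y => t y • a (b y), fun s y => ?_⟩
  simp only [hb]
  have h1 : ((t (s • y))⁻¹ * (s * t y)) • b y = b y := by
    have := ht (s • y)
    rw [hb] at this
    rw [mul_smul, mul_smul, ht, inv_smul_eq_iff, this]
  have h2 := ha (b y) _ h1
  rw [mul_smul, mul_smul, inv_smul_eq_iff] at h2
  exact h2.symm

/-- Stabilizers in `S` are `p`-groups, so an `S`-map `m : Y → X` exists. Its translates `g m g⁻¹`
depend only on `gS`, and averaging them over `G / S` is possible since the index is prime to `p`. -/
theorem exists_equivariant_weights {k : Type*} [Field k] {G : Type*} [Group G] [Finite G] {p : ℕ}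
    [Fact p.Prime] [CharP k p] (S : Sylow p G) {X Y : Type*} [Fintype X] [MulAction G X]
    [MulAction G Y] (h : ∀ P : Subgroup G, IsPGroup p P →
      (MulAction.fixedPoints P Y).Nonempty → (MulAction.fixedPoints P X).Nonempty) :
    ∃ u : Y → X → k, (∀ (g : G) y x, u (g • y) (g • x) = u y x) ∧ ∀ y, ∑ x, u y x = 1 := by
  classical
  have : Fintype (G ⧸ (S : Subgroup G)) := Fintype.ofFinite _
  obtain ⟨m, hm⟩ : ∃ m : Y → X, ∀ (s : S) y, m (s • y) = s • m y := by
    refine exists_equivariant_map fun y => ?_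
    let P : Subgroup G := (MulAction.stabilizer S y).map (S : Subgroup G).subtype
    obtain ⟨x, hx⟩ := h P ((S.2.to_subgroup _).map _) ⟨y, by
      rintro ⟨_, s, hs, rfl⟩
      exact hs⟩
    exact ⟨x, fun s hs => hx ⟨s, s, hs, rfl⟩⟩
  let ψ : Y → G ⧸ (S : Subgroup G) → X := fun y => Quotient.lift (fun g => g • m (g⁻¹ • y)) (by
    intro g h hgh
    have hs : g⁻¹ * h ∈ (S : Subgroup G) := QuotientGroup.leftRel_apply.1 hgh
    have h1 := hm ⟨g⁻¹ * h, hs⟩ (h⁻¹ • y)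
    rw [Subgroup.smul_def, Subgroup.smul_def] at h1
    simp only [smul_smul, mul_inv_cancel_right] at h1 ⊢
    rw [h1, smul_smul, mul_inv_cancel_left])
  have hψ : ∀ (g : G) y c, ψ (g • y) (g • c) = g • ψ y c := by
    intro g y c
    obtain ⟨h, rfl⟩ := QuotientGroup.mk_surjective c
    change (g * h) • m ((g * h)⁻¹ • g • y) = g • (h • m (h⁻¹ • y))
    rw [smul_smul, smul_smul, mul_inv_rev, inv_mul_cancel_right]
  refine ⟨fun y x => ((S : Subgroup G).index : k)⁻¹ * ∑ c, if ψ y c = x then 1 else 0,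
    fun g y x => ?_, fun y => ?_⟩
  · refine congrArg (((S : Subgroup G).index : k)⁻¹ * ·) (Fintype.sum_equiv
      (MulAction.toPerm g : Equiv.Perm (G ⧸ (S : Subgroup G))) _ _ fun c => ?_).symm
    rw [MulAction.toPerm_apply, hψ]
    simp only [smul_left_cancel_iff]
  · rw [← Finset.mul_sum, Finset.sum_comm]
    simp only [Finset.sum_ite_eq, Finset.mem_univ, if_true, Finset.sum_const, Finset.card_univ]
    rw [← Nat.card_eq_fintype_card, ← Subgroup.index_eq_card, nsmul_eq_mul, mul_one,
      inv_mul_cancel₀ (index_cast_ne_zero S)]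

end EquivariantMaps

/-! ### The classes `Ω_X` and their modular relation -/

section RelSyzygy

noncomputable scoped instance {G : Type v} [Group G] (X : FinGSet.{u} G) : Fintype X.carrier :=
  Fintype.ofFinite _

variable {G : Type v} [Group G]

/-- The disjoint union of two `G`-sets. -/
def FinGSet.sum (X Y : FinGSet.{u} G) : FinGSet.{u} G := ⟨X.carrier ⊕ Y.carrier⟩

/-- The product of two `G`-sets. -/
def FinGSet.prod (X Y : FinGSet.{u} G) : FinGSet.{u} G := ⟨X.carrier × Y.carrier⟩

theorem hasFixedPoint_sum {P : Subgroup G} {X Y : FinGSet.{u} G} :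
    HasFixedPoint P (X.sum Y) ↔ HasFixedPoint P X ∨ HasFixedPoint P Y := by
  constructor
  · rintro ⟨x | y, h⟩
    · exact Or.inl ⟨x, fun s => Sum.inl_injective (h s)⟩
    · exact Or.inr ⟨y, fun s => Sum.inr_injective (h s)⟩
  · rintro (⟨x, h⟩ | ⟨y, h⟩)
    · exact ⟨Sum.inl x, fun s => congrArg Sum.inl (h s)⟩
    · exact ⟨Sum.inr y, fun s => congrArg Sum.inr (h s)⟩

theorem hasFixedPoint_prod {P : Subgroup G} {X Y : FinGSet.{u} G} :
    HasFixedPoint P (X.prod Y) ↔ HasFixedPoint P X ∧ HasFixedPoint P Y := by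
  constructor
  · rintro ⟨x, h⟩
    exact ⟨⟨x.1, fun s => congrArg Prod.fst (h s)⟩, ⟨x.2, fun s => congrArg Prod.snd (h s)⟩⟩
  · rintro ⟨⟨x, h⟩, ⟨y, h'⟩⟩
    exact ⟨(x, y), fun s => Prod.ext (h s) (h' s)⟩

variable {k : Type u} [Field k] {p : ℕ}

theorem augmentation_apply (X : FinGSet.{u} G) [Fintype X.carrier] (d : MonoidAlgebra k X.carrier) :
    augmentation k X d = ∑ x, d.coeff x := by
  change Finsupp.linearCombination k (fun _ : X.carrier => (1 : k)) d.coeff = _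
  rw [Finsupp.linearCombination_apply, Finsupp.sum_fintype _ _ fun x => by simp]
  simp

variable (k) in
/-- The relative syzygy in terms of functions with sum zero. -/
noncomputable def relSyzygyEquiv (X : FinGSet.{u} G) [Fintype X.carrier] :
    (augmentation k X).ker.toSubmodule ≃ₗ[k]
      (sumZero X.carrier (Representation.trivial k G k)).toSubmodule :=
  LinearEquiv.ofSubmodules
    ((MonoidAlgebra.coeffLinearEquiv k).trans (Finsupp.linearEquivFunOnFinite k k X.carrier)) _ _
    (by
      ext f
      rw [Submodule.mem_map_equiv, mem_sumZero]
      change augmentation k X _ = 0 ↔ _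
      rw [augmentation_apply]
      rfl)

theorem relSyzygyEquiv_apply (X : FinGSet.{u} G) [Fintype X.carrier]
    (d : (augmentation k X).ker.toSubmodule) (x : X.carrier) :
    (relSyzygyEquiv k X d).1 x = d.1.coeff x := rfl

theorem relSyzygyEquiv_equivariant (X : FinGSet.{u} G) [Fintype X.carrier] (g : G)
    (d : (augmentation k X).ker.toSubmodule) :
    relSyzygyEquiv k X (relSyzygy k X g d) = syz X.carrier (Representation.trivial k G k) g
      (relSyzygyEquiv k X d) :=
  sumZero_ext fun x => by
    rw [relSyzygyEquiv_apply, syz_apply, relSyzygyEquiv_apply]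
    exact coeff_ofMulAction g d.1 x

theorem isSummand_relSyzygy_syz (X : FinGSet.{u} G) [Fintype X.carrier] :
    IsSummand (relSyzygy k X) (syz X.carrier (Representation.trivial k G k)) :=
  IsSummand.of_linearEquiv (relSyzygyEquiv k X) (relSyzygyEquiv_equivariant X)

theorem isSummand_syz_relSyzygy (X : FinGSet.{u} G) [Fintype X.carrier] :
    IsSummand (syz X.carrier (Representation.trivial k G k)) (relSyzygy k X) :=
  IsSummand.of_linearEquiv (relSyzygyEquiv k X).symm fun g d => by
    rw [LinearEquiv.symm_apply_eq, relSyzygyEquiv_equivariant, LinearEquiv.apply_symm_apply]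

theorem finrank_relSyzygy (X : FinGSet.{u} G) :
    Module.finrank k (augmentation k X).ker.toSubmodule + 1 = Nat.card X.carrier := by
  rw [(relSyzygyEquiv k X).finrank_eq]
  have h := LinearMap.finrank_range_add_finrank_ker
    (∑ x, (LinearMap.proj x : (X.carrier → k) →ₗ[k] k))
  have h1 : LinearMap.range (∑ x, (LinearMap.proj x : (X.carrier → k) →ₗ[k] k)) = ⊤ := by
    classical
    rw [LinearMap.range_eq_top]
    intro c
    obtain ⟨x⟩ := X.nonempty
    exact ⟨Pi.single x c, by simp [LinearMap.sum_apply]⟩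
  rw [h1, finrank_top, Module.finrank_self, Module.finrank_pi, add_comm,
    ← Nat.card_eq_fintype_card] at h
  exact h

variable [Finite G] [Fact p.Prime] [CharP k p]

theorem isTamePair_relSyzygy (S : Sylow p G) (X Y : FinGSet.{u} G)
    (hX : ¬ HasFixedPoint (S : Subgroup G) X)
    (h : ∀ P : Subgroup G, IsPGroup p P → (HasFixedPoint P X ↔ HasFixedPoint P Y)) :
    IsTamePair (S : Subgroup G) (relSyzygy k Y) (relSyzygy k X) := by
  obtain ⟨u, hu, hu1⟩ := exists_equivariant_weights (k := k) S (X := X.carrier) (Y := Y.carrier)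
    fun P hP => (h P hP).2
  obtain ⟨v, hv, hv1⟩ := exists_equivariant_weights (k := k) S (X := Y.carrier) (Y := X.carrier)
    fun P hP => (h P hP).1
  exact (isTamePair_syz (fun x hx => hX ⟨x, hx⟩) u hu hu1 v hv hv1).of_isSummand
    (isSummand_relSyzygy_syz Y) (isSummand_relSyzygy_syz X)

/-- The identity has trace `|X| - 1 = -1` in `k`, because `p` divides `|X|` when `S` has no fixed
points. -/
theorem isCappedDade_relSyzygy (S : Sylow p G) (X : FinGSet.{u} G)
    (hX : ¬ HasFixedPoint (S : Subgroup G) X) : IsCappedDade p (relSyzygy k X) := by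
  rw [isCappedDade_iff S]
  have := Module.Finite.equiv (relSyzygyEquiv k X).symm
  refine ⟨this, isTamePair_relSyzygy S X X hX fun _ _ => Iff.rfl, LinearMap.id,
    fun _ _ => rfl, ?_⟩
  have h1 := dvd_card_of_forall_notMem S X.carrier fun x hx => hX ⟨x, hx⟩
  rw [← finrank_relSyzygy (k := k), ← CharP.cast_eq_zero_iff k p] at h1
  rw [LinearMap.trace_id]
  intro h2
  rw [Nat.cast_add, h2] at h1
  simp at h1

open Classical in
variable (k) in
/-- The class of the relative syzygy in the Dade group, by convention trivial if `X` has a point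
fixed by a Sylow subgroup. -/
noncomputable def omegaClass (S : Sylow p G) (X : FinGSet.{u} G) : DadeGroup k G p :=
  if h : HasFixedPoint (S : Subgroup G) X then 0
  else DadeGroup.mk (relSyzygy k X) (isCappedDade_relSyzygy S X h)

theorem omegaClass_of_hasFixedPoint {S : Sylow p G} {X : FinGSet.{u} G}
    (h : HasFixedPoint (S : Subgroup G) X) : omegaClass k S X = 0 := dif_pos h

theorem omegaClass_of_not_hasFixedPoint {S : Sylow p G} {X : FinGSet.{u} G}
    (h : ¬ HasFixedPoint (S : Subgroup G) X) :
    omegaClass k S X = DadeGroup.mk (relSyzygy k X) (isCappedDade_relSyzygy S X h) := dif_neg h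

theorem omegaClass_congr (S : Sylow p G) {X Y : FinGSet.{u} G}
    (h : ∀ P : Subgroup G, IsPGroup p P → (HasFixedPoint P X ↔ HasFixedPoint P Y)) :
    omegaClass k S X = omegaClass k S Y := by
  by_cases hX : HasFixedPoint (S : Subgroup G) X
  · rw [omegaClass_of_hasFixedPoint hX, omegaClass_of_hasFixedPoint ((h S S.2).1 hX)]
  · have hY := fun hY => hX ((h S S.2).2 hY)
    rw [omegaClass_of_not_hasFixedPoint hX, omegaClass_of_not_hasFixedPoint hY]
    exact DadeGroup.mk_eq_mk S _ _ (isTamePair_relSyzygy S X Y hX h).symm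

theorem HasFixedPoint.of_sylow {S : Sylow p G} {X : FinGSet.{u} G}
    (h : HasFixedPoint (S : Subgroup G) X) {P : Subgroup G} (hP : IsPGroup p P) :
    HasFixedPoint P X := by
  obtain ⟨Q, hQ⟩ := hP.exists_le_sylow
  obtain ⟨x, hx⟩ := h
  obtain ⟨y, hy⟩ := exists_fixedPoint_of_sylow Q S hx
  exact ⟨y, fun s => hy ⟨s, hQ s.2⟩⟩

theorem omegaClass_sum_add_omegaClass_prod (S : Sylow p G) (X Y : FinGSet.{u} G) :
    omegaClass k S (X.sum Y) + omegaClass k S (X.prod Y) = omegaClass k S X + omegaClass k S Y := by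
  -- If `S` fixes a point of `X`, so does every `p`-subgroup up to conjugacy; then `X × Y` and `Y`
  -- have the same superclass function.
  by_cases hX : HasFixedPoint (S : Subgroup G) X
  · rw [omegaClass_of_hasFixedPoint (hasFixedPoint_sum.2 (Or.inl hX)),
      omegaClass_of_hasFixedPoint hX, omegaClass_congr S (X := X.prod Y) (Y := Y) fun P hP => by
        rw [hasFixedPoint_prod, and_iff_right (hX.of_sylow hP)]]
  by_cases hY : HasFixedPoint (S : Subgroup G) Y
  · rw [omegaClass_of_hasFixedPoint (hasFixedPoint_sum.2 (Or.inr hY)),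
      omegaClass_of_hasFixedPoint hY, omegaClass_congr S (X := X.prod Y) (Y := X) fun P hP => by
        rw [hasFixedPoint_prod, and_iff_left (hY.of_sylow hP)], add_comm]
  have hs : ¬ HasFixedPoint (S : Subgroup G) (X.sum Y) := fun h =>
    (hasFixedPoint_sum.1 h).elim hX hY
  have hp : ¬ HasFixedPoint (S : Subgroup G) (X.prod Y) := fun h =>
    hX (hasFixedPoint_prod.1 h).1
  rw [omegaClass_of_not_hasFixedPoint hX, omegaClass_of_not_hasFixedPoint hY,
    omegaClass_of_not_hasFixedPoint hs, omegaClass_of_not_hasFixedPoint hp, add_comm,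
    DadeGroup.mk_add_mk, DadeGroup.mk_add_mk]
  symm
  refine DadeGroup.mk_eq_mk_of_isSummand _ _ ?_
  have hp' : IsSummand (syz (X.carrier × Y.carrier) (Representation.trivial k G k))
      (relSyzygy k (X.prod Y)) :=
    @isSummand_syz_relSyzygy G _ k _ (X.prod Y)
      (instFintypeProd X.carrier Y.carrier)
  have hs' : IsSummand (syz (X.carrier ⊕ Y.carrier) (Representation.trivial k G k))
      (relSyzygy k (X.sum Y)) :=
    @isSummand_syz_relSyzygy G _ k _ (X.sum Y)
      (instFintypeSum X.carrier Y.carrier)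
  have h1 := (isSummand_relSyzygy_syz (k := k) X).tprod (isSummand_relSyzygy_syz (k := k) Y)
  have h2 := (isSummand_tprod_syz (X := X.carrier)
    (syz Y.carrier (Representation.trivial k G k))).trans isSummand_syz_syz
  have h3 := isSummand_syz_tprod (X := X.carrier × Y.carrier)
    (syz (X.carrier ⊕ Y.carrier) (Representation.trivial k G k))
  exact (h1.trans (h2.trans h3)).trans (hp'.tprod hs')

end RelSyzygy

/-! ### Valuations on finite distributive lattices -/

section Valuation

variable {T A : Type*} [PartialOrder T] [Finite T] [AddCommGroup A]

/-- A valuation on the lattice of lower sets of a finite partial order extends to a homomorphism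
on the group of all functions. -/
theorem exists_addMonoidHom_of_valuation (v : LowerSet T → A) (h0 : v ⊥ = 0)
    (hv : ∀ L L', v (L ⊔ L') + v (L ⊓ L') = v L + v L') :
    ∃ Φ : (T → ℤ) →+ A, (∀ (L : LowerSet T) (f : T → ℤ), (∀ t ∈ L, f t = 1) →
      (∀ t, t ∉ L → f t = 0) → Φ f = v L) ∧ ∀ f, Φ f ∈ AddSubgroup.closure (Set.range v) := by
  classical
  have := Fintype.ofFinite T
  have : Finite (LowerSet T) := Finite.of_injective _ SetLike.coe_injective
  -- The weight of `t` is the jump of `v` across `t`. Removing a maximal element `t` from `L` lowers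
  -- `v L` by exactly `w t`, so `v L` is the sum of the weights over `L`.
  let w : T → A := fun t => v (LowerSet.Iic t) - v (LowerSet.Iio t)
  have hw : ∀ L : LowerSet T, ∑ t, (if t ∈ L then w t else 0) = v L := by
    intro L
    induction L using WellFoundedLT.induction with
    | ind L ih =>
    rcases (L : Set T).eq_empty_or_nonempty with hL | hL
    · obtain rfl : L = ⊥ := SetLike.coe_injective hL
      simp [h0]
    · obtain ⟨t, ht', hmax⟩ := (Set.toFinite (L : Set T)).exists_maximal hL
      have ht : t ∈ L := ht'
      have hmax' : ∀ s ∈ L, t ≤ s → s = t := fun s hs hts => (hmax hs hts).antisymm hts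
      have h1 : L.erase t ⊔ LowerSet.Iic t = L := LowerSet.erase_sup_Iic ht hmax'
      have h2 : L.erase t ⊓ LowerSet.Iic t = LowerSet.Iio t := by
        ext s
        simp only [LowerSet.coe_inf, LowerSet.coe_erase, Set.mem_inter_iff, Set.mem_sdiff,
          LowerSet.coe_Iic, LowerSet.coe_Iio, UpperSet.coe_Ici, Set.mem_Ici, Set.mem_Iic,
          Set.mem_Iio, SetLike.mem_coe, lt_iff_le_not_ge]
        exact ⟨fun h => ⟨h.2, h.1.2⟩, fun h => ⟨⟨L.lower h.1 ht, h.2⟩, h.1⟩⟩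
      have h3 := hv (L.erase t) (LowerSet.Iic t)
      rw [h1, h2] at h3
      have h4 : v L = v (L.erase t) + w t := by
        rw [← add_sub_assoc, ← h3, add_sub_cancel_right]
      have h5 : ∀ s, (if s ∈ L then w s else 0) =
          (if s ∈ L.erase t then w s else 0) + if s = t then w s else 0 := by
        intro s
        have h6 : s ∈ L.erase t ↔ s ∈ L ∧ ¬ t ≤ s := Iff.rfl
        by_cases hst : s = t
        · subst hst
          rw [if_pos ht, if_neg fun h => (h6.1 h).2 le_rfl, if_pos rfl, zero_add]
        · rw [if_neg hst, add_zero]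
          exact if_congr ⟨fun h => h6.2 ⟨h, fun hts => hst (hmax' s h hts)⟩,
            fun h => (h6.1 h).1⟩ rfl rfl
      rw [Finset.sum_congr rfl fun s _ => h5 s, Finset.sum_add_distrib,
        ih _ (LowerSet.erase_lt.2 ht), h4]
      simp
  refine ⟨⟨⟨fun f => ∑ t, f t • w t, by simp⟩, fun f g => by
    simp [add_smul, Finset.sum_add_distrib]⟩, fun L f h1 h2 => ?_, fun f => ?_⟩
  · rw [← hw]
    refine Finset.sum_congr rfl fun t _ => ?_
    split_ifs with ht
    · rw [h1 t ht, one_smul]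
    · rw [h2 t ht, zero_smul]
  · exact sum_mem fun t _ => zsmul_mem (sub_mem (AddSubgroup.subset_closure (Set.mem_range_self _))
      (AddSubgroup.subset_closure (Set.mem_range_self _))) _

end Valuation

/-! ### `p`-subgroups up to conjugacy -/

section PSubgroups

variable (G : Type v) [Group G] (p : ℕ)

/-- The `p`-subgroups of `G`, preordered by inclusion up to conjugation. -/
structure PSubgroup where
  toSubgroup : Subgroup G
  isPGroup : IsPGroup p toSubgroup

variable {G p}

instance : Preorder (PSubgroup G p) where
  le P Q := ∃ g : G, ∀ x ∈ P.1, g⁻¹ * x * g ∈ Q.1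
  le_refl P := ⟨1, fun x hx => by simpa using hx⟩
  le_trans P Q R := by
    rintro ⟨g, hg⟩ ⟨h, hh⟩
    exact ⟨g * h, fun x hx => by simpa [mul_assoc] using hh _ (hg x hx)⟩

theorem PSubgroup.le_def {P Q : PSubgroup G p} :
    P ≤ Q ↔ ∃ g : G, ∀ x ∈ P.1, g⁻¹ * x * g ∈ Q.1 := Iff.rfl

instance [Finite G] : Finite (PSubgroup G p) :=
  Finite.of_injective PSubgroup.toSubgroup fun P Q h => by cases P; cases Q; cases h; rfl

theorem HasFixedPoint.of_le {X : FinGSet.{u} G} {P Q : PSubgroup G p} (h : HasFixedPoint Q.1 X)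
    (hPQ : P ≤ Q) : HasFixedPoint P.1 X := by
  obtain ⟨g, hg⟩ := PSubgroup.le_def.1 hPQ
  obtain ⟨x, hx⟩ := h
  refine ⟨g • x, fun s => ?_⟩
  have := hx ⟨_, hg s s.2⟩
  rw [Subgroup.smul_def] at this ⊢
  rw [← inv_smul_eq_iff, smul_smul, smul_smul]
  exact this

/-- Passing through `Fin n` moves a `G`-set into the universe of `k`, where the syzygies must live.
-/
theorem exists_finGSet (X : Type*) [Finite X] [Nonempty X] [MulAction G X] :
    ∃ Y : FinGSet.{u} G, ∀ P : Subgroup G,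
      HasFixedPoint P Y ↔ (MulAction.fixedPoints P X).Nonempty := by
  obtain ⟨n, inst, e, he⟩ := exists_fin_action (G := G) X
  have : Nonempty (Fin n) := e.nonempty_congr.1 ‹_›
  refine ⟨⟨ULift.{u} (Fin n)⟩, fun P => ⟨?_, ?_⟩⟩
  · rintro ⟨⟨y⟩, hy⟩
    refine ⟨e.symm y, fun s => e.injective ?_⟩
    have := congrArg ULift.down (hy s)
    rw [Subgroup.smul_def] at this ⊢
    rw [he, e.apply_symm_apply]
    exact this
  · rintro ⟨x, hx⟩
    refine ⟨⟨e x⟩, fun s => congrArg ULift.up ?_⟩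
    change (s : G) • e x = e x
    rw [← he]
    exact congrArg e (hx s)

variable [Finite G]

/-- Every nonempty family of `p`-subgroups closed under subconjugation is the family of
`p`-subgroups with fixed points on some `G`-set. -/
theorem exists_hasFixedPoint_iff {s : Set (PSubgroup G p)} (hs : s.Nonempty) (hl : IsLowerSet s) :
    ∃ X : FinGSet.{u} G, ∀ P : PSubgroup G p, HasFixedPoint P.1 X ↔ P ∈ s := by
  have : Nonempty (Σ P : s, G ⧸ P.1.1) := ⟨⟨⟨_, hs.some_mem⟩, (1 : G)⟩⟩
  -- On the disjoint union of the `G / Q` with `Q ∈ s`, a subgroup has a fixed point iff it is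
  -- subconjugate to some such `Q`.
  obtain ⟨Y, hY⟩ := exists_finGSet.{u} (G := G) (Σ P : s, G ⧸ P.1.1)
  refine ⟨Y, fun P => (hY P.1).trans ⟨?_, fun hP => ?_⟩⟩
  · rintro ⟨⟨Q, c⟩, hc⟩
    obtain ⟨g, rfl⟩ := QuotientGroup.mk_surjective c
    refine hl (PSubgroup.le_def.2 ⟨g, fun x hx => ?_⟩) Q.2
    have h1 : (⟨Q, ((x * g : G) : G ⧸ Q.1.1)⟩ : Σ P : s, G ⧸ P.1.1) = ⟨Q, (g : G ⧸ Q.1.1)⟩ :=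
      hc ⟨x, hx⟩
    have h2 := QuotientGroup.eq.1 (eq_of_heq (Sigma.mk.inj h1).2).symm
    rwa [← mul_assoc] at h2
  · refine ⟨⟨⟨P, hP⟩, ((1 : G) : G ⧸ P.1)⟩, fun x => ?_⟩
    change (⟨⟨P, hP⟩, ((x * 1 : G) : G ⧸ P.1)⟩ : Σ P : s, G ⧸ P.1.1) = _
    rw [mul_one]
    congr 1
    exact QuotientGroup.eq.2 (by simp)

end PSubgroups

/-! ### The homomorphism from superclass functions -/

section Psi

variable {k : Type u} [Field k] {p : ℕ} [Fact p.Prime] [CharP k p] {G : Type v} [Group G]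
  [Finite G]

theorem exists_hom_superclass (S : Sylow p G) :
    ∃ Ψ : Superclass G p →+ AddSubgroup.closure (Set.range (omegaClass.{u, v} k S)),
      Function.Surjective Ψ ∧
      ∀ X : FinGSet.{u} G, (Ψ (omega p X) : DadeGroup k G p) = omegaClass k S X := by
  classical
  -- As `G` is finite, mutually subconjugate subgroups are conjugate, so `T` is the poset of
  -- conjugacy classes of `p`-subgroups.
  let T := Antisymmetrization (PSubgroup G p) (· ≤ ·)
  let rep : T → PSubgroup G p := ofAntisymmetrization _
  have : Finite T := Quotient.finite _
  let pre : LowerSet T → Set (PSubgroup G p) := fun L => {P | toAntisymmetrization (· ≤ ·) P ∈ L}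
  have hpre : ∀ L, IsLowerSet (pre L) := fun L P Q hQP hP =>
    L.lower (toAntisymmetrization_le_toAntisymmetrization_iff.2 hQP) hP
  let triv : PSubgroup G p := ⟨⊥, IsPGroup.of_bot⟩
  have htriv : ∀ P : PSubgroup G p, triv ≤ P := fun P => ⟨1, fun x hx => by
    rw [Subgroup.mem_bot.1 hx]
    simp⟩
  have hne : ∀ L : LowerSet T, L ≠ ⊥ → triv ∈ pre L := fun L hL => by
    obtain ⟨t, ht⟩ := Set.nonempty_iff_ne_empty.2 fun h => hL (SetLike.coe_injective h)
    refine L.lower ?_ ht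
    rw [← toAntisymmetrization_ofAntisymmetrization (· ≤ ·) t]
    exact toAntisymmetrization_le_toAntisymmetrization_iff.2 (htriv _)
  have hex : ∀ L : LowerSet T, ∃ X : FinGSet.{u} G, L ≠ ⊥ →
      ∀ P : PSubgroup G p, HasFixedPoint P.1 X ↔ P ∈ pre L := fun L => by
    by_cases hL : L = ⊥
    · exact ⟨(exists_finGSet.{u} (G := G) G).choose, fun h => absurd hL h⟩
    · obtain ⟨X, hX⟩ := exists_hasFixedPoint_iff ⟨_, hne L hL⟩ (hpre L)
      exact ⟨X, fun _ => hX⟩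
  choose X hX using hex
  -- The empty lower set is the support of no `ω_X`, as `X` is non-empty; it gets the value 0. This
  -- creates no exception to the modular law, since any two non-empty lower sets both contain the
  -- trivial subgroup.
  let v : LowerSet T → DadeGroup k G p := fun L => if L = ⊥ then 0 else omegaClass k S (X L)
  have hv : ∀ L, L ≠ ⊥ → ∀ Y : FinGSet.{u} G,
      (∀ P : PSubgroup G p, HasFixedPoint P.1 Y ↔ P ∈ pre L) → omegaClass k S Y = v L := by
    intro L hL Y hY
    rw [show v L = omegaClass k S (X L) from if_neg hL]
    exact omegaClass_congr S fun P hP => (hY ⟨P, hP⟩).trans (hX L hL ⟨P, hP⟩).symm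
  obtain ⟨Φ, hΦ, hΦ'⟩ := exists_addMonoidHom_of_valuation v (if_pos rfl) fun L L' => by
    by_cases hL : L = ⊥
    · rw [hL, bot_sup_eq, bot_inf_eq, add_comm]
    by_cases hL' : L' = ⊥
    · rw [hL', sup_bot_eq, inf_bot_eq]
    have h1 : L ⊔ L' ≠ ⊥ := fun h => hL (sup_eq_bot_iff.1 h).1
    have h2 : L ⊓ L' ≠ ⊥ := fun h => by
      have : toAntisymmetrization (· ≤ ·) triv ∈ L ⊓ L' := ⟨hne L hL, hne L' hL'⟩
      rw [h] at this
      exact this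
    rw [← hv _ h1 ((X L).sum (X L')) fun P => by
        rw [hasFixedPoint_sum, hX L hL, hX L' hL']; exact Iff.rfl,
      ← hv _ h2 ((X L).prod (X L')) fun P => by
        rw [hasFixedPoint_prod, hX L hL, hX L' hL']; exact Iff.rfl,
      omegaClass_sum_add_omegaClass_prod, hv L hL (X L) (hX L hL), hv L' hL' (X L') (hX L' hL')]
  have hv' : AddSubgroup.closure (Set.range v) ≤
      AddSubgroup.closure (Set.range (omegaClass.{u, v} k S)) := by
    rw [AddSubgroup.closure_le]
    rintro _ ⟨L, rfl⟩
    by_cases hL : L = ⊥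
    · rw [show v L = 0 from if_pos hL]
      exact zero_mem _
    · rw [← hv L hL (X L) (hX L hL)]
      exact AddSubgroup.subset_closure ⟨_, rfl⟩
  let Ψ : Superclass G p →+ AddSubgroup.closure (Set.range (omegaClass.{u, v} k S)) :=
    -- A superclass function is read off on one representative of each class.
    (Φ.comp ⟨⟨fun f t => f.1 ⟨(rep t).1, (rep t).2⟩, rfl⟩, fun _ _ => rfl⟩).codRestrict _
      fun f => hv' (hΦ' _)
  have hΨ : ∀ X : FinGSet.{u} G, (Ψ (omega p X) : DadeGroup k G p) = omegaClass k S X := by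
    intro Y
    let L : LowerSet T := ⟨{t | HasFixedPoint (rep t).1 Y}, fun t t' htt' ht =>
      HasFixedPoint.of_le ht (ofAntisymmetrization_le_ofAntisymmetrization_iff.2 htt')⟩
    have hLY : ∀ P : PSubgroup G p, HasFixedPoint P.1 Y ↔ P ∈ pre L := fun P => by
      have h : AntisymmRel (· ≤ ·) (rep (toAntisymmetrization (· ≤ ·) P)) P :=
        Quotient.mk_out (s := AntisymmRel.setoid (PSubgroup G p) (· ≤ ·)) P
      exact ⟨fun hP => hP.of_le h.1, fun hP => HasFixedPoint.of_le hP h.2⟩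
    have hL : L ≠ ⊥ := fun h => by
      obtain ⟨y⟩ := Y.nonempty
      have h1 : triv ∈ pre L := (hLY triv).1 ⟨y, fun s => by
        have : (s : G) = 1 := Subgroup.mem_bot.1 s.2
        rw [Subgroup.smul_def, this, one_smul]⟩
      rw [h] at h1
      exact h1
    rw [hv L hL Y hLY]
    exact hΦ L _ (fun t ht => if_pos ht) fun t ht => if_neg ht
  refine ⟨Ψ, ?_, hΨ⟩
  have h1 : AddSubgroup.closure (Set.range (omegaClass.{u, v} k S)) ≤
      Ψ.range.map (AddSubgroup.subtype _) := by
    rw [AddSubgroup.closure_le]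
    rintro _ ⟨Y, rfl⟩
    exact ⟨_, ⟨omega p Y, rfl⟩, hΨ Y⟩
  intro a
  obtain ⟨b, ⟨f, rfl⟩, hb⟩ := h1 a.2
  exact ⟨f, Subtype.ext hb⟩

end Psi
end Dade

theorem theorem1p4 {k : Type u} [Field k] [IsAlgClosed k] (p : ℕ) [Fact p.Prime] [CharP k p]
    {G : Type v} [Group G] [Finite G] (S : Sylow p G) :
    Equivalence (Dade.Compatible (k := k) (G := G) (p := p)) ∧
    ∃ _ : AddCommGroup (Dade.DadeGroup k G p),
      (∀ M N : Dade.CappedDadeModule k G p,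
        ∃ h : Dade.IsCappedDade p (M.ρ.tprod N.ρ),
          Dade.DadeGroup.mk M.ρ M.isCappedDade + Dade.DadeGroup.mk N.ρ N.isCappedDade =
            Dade.DadeGroup.mk (M.ρ.tprod N.ρ) h) ∧
      ∃ Ω : Dade.FinGSet.{u} G → Dade.DadeGroup k G p,
        (∀ X, ¬ Dade.HasFixedPoint (S : Subgroup G) X →
          ∃ h : Dade.IsCappedDade p (Dade.relSyzygy k X),
            Ω X = Dade.DadeGroup.mk (Dade.relSyzygy k X) h) ∧
        (∀ X, Dade.HasFixedPoint (S : Subgroup G) X → Ω X = 0) ∧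
        ∃ Ψ : Dade.Superclass G p →+ AddSubgroup.closure (Set.range Ω),
          Function.Surjective Ψ ∧
          ∀ X : Dade.FinGSet.{u} G, (Ψ (Dade.omega p X) : Dade.DadeGroup k G p) = Ω X :=
  ⟨Dade.compatible_equivalence k G p, Dade.instAddCommGroupDadeGroup,
    fun M N => ⟨M.isCappedDade.tprod N.isCappedDade, Dade.DadeGroup.mk_add_mk _ _⟩,
    Dade.omegaClass k S,
    fun X hX => ⟨Dade.isCappedDade_relSyzygy S X hX, Dade.omegaClass_of_not_hasFixedPoint hX⟩,
    fun _ hX => Dade.omegaClass_of_hasFixedPoint hX, Dade.exists_hom_superclass S⟩
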